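/- Fix positive integers $N,K$, a vector space $\mathcal V$ over a field $\mathcal F$, and a linear code with encoding maps $\Phi_i:\mathcal V^K\to\mathcal W_i$, $i=1,\dots,N$, together with re-encoding functions and, for every recovery set of an object (a set of servers whose symbols determine its value), a decoding function. Consider the CausalEC algorithm, described below, which stores the objects $X_1,\dots,X_K$ (initial value $0\in\mathcal V$) at $N$ servers by means of this code. Servers communicate over reliable asynchronous FIFO channels; each client has a distinct natural number as identifier and talks to one fixed server; operations have unique identifiers; nodes may halt; and each client has at most one pending operation at any time. **The algorithm.** Let $\mathcal X_s$ be the set of objects on which $\Phi_s$ depends, and $\Gamma_{s,X}(y,a,b)$ the re-encoding function, which turns the symbol $y\in\mathcal W_s$ of a data vector whose $X$-entry is $a$ into that of the vector with $X$-entry $b$. A tag is a pair $t=(t.ts,t.id)\in\mathbb N^N\times\mathbb N$; $t<t'$ means $t.ts<t'.ts$, or $t.ts\not>t'.ts$ and $t.id<t'.id$; and $t\le t'$ means $t<t'$ or $t=t'$. (If a set of tags below has no highest element, "highest" or "max" may be any of its elements.) Server $s$ keeps a vector clock $vc=0$, a set $InQueue=\emptyset$, for each object $X$ a list $L[X]=\{(0,0)\}$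 of tag-value pairs and a set $DelL[X]=\emptyset$ of tag-server pairs, a symbol $M.val=0\in\mathcal W_s$ with tags $M.tag[X]=0$, tags $tmax[X]=0$, and a set $ReadL=\emptyset$ of pending reads $(c,o,X,\tau,\bar w)$ with $c$ a client or "localhost", $o$ an operation identifier, $\tau$ a vector of tags and $\bar w\in\prod_i(\mathcal W_i\cup\{\bot\})$ (initial values as shown). A client sends its request to its server and completes its operation on receiving the response. The following steps of server $s$ are atomic; loops take the objects in any order. * *write$(o,X,v)$ from client $c$:* increase $vc[s]$ by 1, let $t=(vc,\mathrm{id}(c))$, add $(t,v)$ to $L[X]$, acknowledge, send $app(X,v,t)$ to all other servers, and return $v$ to all pending client reads of $X$, removing them from $ReadL$. * *read$(o,X)$ from client $c$:* if $L[X]\ne\emptyset$ and its highest tag is $\ge M.tag[X]$, return the value of the highest tagged entry; else if $\{s\}$ is a recovery set of $X$, return the value decoded from $M.val$; else add $(c,o,X,M.tag,\bar w)$ to $ReadL$, where $w_s=M.val$ and $w_i=\bot$ for $i\neq s$, and send $val\_inq(c,o,X,M.tag)$ to all other servers. * *$app(X,v,t)$ from $j$:* add $(j,X,v,t)$ to $InQueue$.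 *$del(X,t)$ from $j$:* add $(t,j)$ to $DelL[X]$. * *$val\_inq(c,o,X,\tau)$ from $j$:* if $(\tau[X],v)\in L[X]$ for some $v$, send $val\_resp(X,v,c,o,\tau)$ to $j$. Otherwise start with $R=M$; for each $Y\in\mathcal X_s$ with $M.tag[Y]\ne\tau[Y]$ for which there is a unique $a$ with $(M.tag[Y],a)\in L[Y]$, put $R.val\leftarrow\Gamma_{s,Y}(R.val,a,0)$, $R.tag[Y]\leftarrow 0$ and then, if there is a unique $b$ with $(\tau[Y],b)\in L[Y]$, $R.val\leftarrow\Gamma_{s,Y}(R.val,0,b)$, $R.tag[Y]\leftarrow\tau[Y]$; send $val\_resp\_encoded(R,c,o,X,\tau)$ to $j$. * *$val\_resp(X,v,c,o,\tau)$:* if there is an entry $(c,o,X,\tau,\bar w)\in ReadL$, remove it and return $v$ to $c$, or, if $c$ is localhost, add $(\tau[X],v)$ to $L[X]$. * *$val\_resp\_encoded(R,c,o,X,\tau)$ from $j$:* if there is an entry $(c,o,X,\tau,\bar w)\in ReadL$, start with $y=R.val$. For each $Y\in\mathcal X_j$ with $\tau[Y]\ne R.tag[Y]$: if $R.tag[Y]\neq0$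 and there is a unique $a$ with $(R.tag[Y],a)\in L[Y]$, put $y\leftarrow\Gamma_{j,Y}(y,a,0)$; if $R.tag[Y]\ne0$ and there is no unique such $a$, record an error; if there was no such error for $Y$ and there is a unique $b$ with $(\tau[Y],b)\in L[Y]$, put $y\leftarrow\Gamma_{j,Y}(y,0,b)$; otherwise record an error. If no error was recorded, set the $j$-th entry of $\bar w$ in $ReadL$ to $y$; if now the non-$\bot$ entries contain a recovery set of $X$, decode a value $v$ of $X$ from it, remove the entry from $ReadL$, and return $v$ to $c$, or, if $c$ is localhost, add $(M.tag[X],v)$ to $L[X]$. * *Apply (internal, if $InQueue\neq\emptyset$):* let $(j,X,v,t)$ be an element of $InQueue$ with minimal $t.ts$. If $t.ts[p]\le vc[p]$ for all $p\ne j$ and $t.ts[j]=vc[j]+1$, remove it from $InQueue$, put $vc[j]\leftarrow t.ts[j]$, add $(t,v)$ to $L[X]$, return $v$ to all pending client reads of $X$ with $\tau[X]\le t$, and remove these and all localhost reads of $X$ with $\tau[X]=t$ from $ReadL$. * *Encoding (internal):* first, for every $X\in\mathcal X_s$ with $L[X]\ne\emptyset$ whose highest tag $h$ in $L[X]$ is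 $>M.tag[X]$: if $(M.tag[X],a)\in L[X]$ for some $a$, take $b$ with $(h,b)\in L[X]$, put $M.val\leftarrow\Gamma_{s,X}(M.val,a,b)$, $M.tag[X]\leftarrow h$, add $(h,s)$ to $DelL[X]$, and send $del(X,h)$ to all other servers $i$ with $X\in\mathcal X_i$; otherwise, if there is no localhost read of $X$ in $ReadL$ with $\tau[X]=M.tag[X]$, add $(\text{localhost},o,X,M.tag,\bar w)$ with a fresh $o$ and $\bar w$ as for a read, and send $val\_inq(\text{localhost},o,X,M.tag)$ to all other servers. Then, for every $X\notin\mathcal X_s$ with $L[X]\neq\emptyset$ and highest tag $>M.tag[X]$: let $A$ be the set of tags $t>M.tag[X]$ in $L[X]$ such that for each $i$ with $X\in\mathcal X_i$ there is $(t',i)\in DelL[X]$ with $t'\ge t$; if $A\ne\emptyset$, put $M.tag[X]\leftarrow\max A$, add $(\max A,s)$ to $DelL[X]$, and send $del(X,\max A)$ to all other servers. * *Garbage collection (internal):* for every $X$, let $S$ be the set of tags $t$ such that for every server $i$ there is $(t',i)\in DelL[X]$ with $t'\ge t$; put $tmax[X]\leftarrow\max S$ (unchanged if $S=\emptyset$).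 Let $T$ be the set of tags $\tau[X]<M.tag[X]$ of the entries of $ReadL$. Remove from $L[X]$ the entries with tags $t\notin T$ and $t\le tmax[X]$ if either $tmax[X]=M.tag[X]$, $(M.tag[X],i)\in DelL[X]$ for all $i$, and $L[X]$ is empty or has highest tag $\le M.tag[X]$, or $tmax[X]<M.tag[X]$ and $X\notin\mathcal X_s$; in all other cases remove the entries with tags $t\notin T$ and $t<tmax[X]$. Finally, let $U$ be the set of tags $t$ such that for each $i$ with $X\in\mathcal X_i$ there is $(t',i)\in DelL[X]$ with $t'\ge t$; if $U\ne\emptyset$ and $X\in\mathcal X_s$, send $del(X,\max U)$ to all other servers. **The claim.** Let $\beta$ be any finite or infinite execution of the algorithm. The operations of $\beta$ are the reads and writes invoked by clients and, for every object, one initial write of the value $0$. For operations $\pi_1,\pi_2$ of the same client write $\pi_1\to\pi_2$ if $\pi_1$ is invoked before $\pi_2$. An invoked operation $\pi$ has a timestamp if the server of its client sends a response to it in $\beta$; the timestamp $ts(\pi)\in\mathbb N^N$ is then the vector clock of this server at the first such point. Initial writes have timestamp $0$. Vector clocks are compared componentwise. Define $\pi_1\leadsto\pi_2$ if one of the following holds: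 * both have timestamps and $ts(\pi_1)<ts(\pi_2)$; * both have timestamps, $ts(\pi_1)=ts(\pi_2)$, $\pi_1$ is a write and $\pi_2$ is a read; * both are reads with timestamps, $ts(\pi_1)=ts(\pi_2)$, and $\pi_1\to\pi_2$; * $\pi_1$ has a timestamp and $\pi_2$ has none. For a strict partial order $\prec$ on the operations and a completed read $\pi$ of an object $X$ that returns $v$, say that $\pi$ reads from a write $\phi$ with respect to $\prec$ if $\phi\prec\pi$, $\phi$ writes $v$ to $X$, and no write $\omega$ with $\phi\prec\omega\prec\pi$ writes $v$ to $X$. Call $\beta$ causally consistent if there is a strict partial order $\prec$ on its operations such that $\pi_1\to\pi_2$ implies $\pi_1\prec\pi_2$, and every completed read reads from a unique write with respect to $\prec$. Then $\beta$ is causally consistent. More precisely: 1. $\leadsto$ is a strict partial order on the operations of $\beta$; 2. $\pi_1\to\pi_2$ implies $\pi_1\leadsto\pi_2$; 3. every completed read reads from some write with respect to $\leadsto$; 4. there is a strict partial order $\prec$ that extends $\leadsto$ and shows that $\beta$ is causally consistent; in particular, every completed read reads from a unique write with respect to $\prec$. -/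

import Mathlib

/-!
The CausalEC protocol as a transition system: clients, servers, reliable channels, its executions,
the timestamps of operations, and causal consistency.
Servers are `Fin N`, objects are `Fin K`, `C` is the set of clients, `I` the set of operation
identifiers, `V` the alphabet of the objects and `W i` the alphabet of the codeword symbol of
server `i`.
-/

noncomputable section

open Classical

namespace CausalEC

universe uF uV uW uC uI

/-! ### The erasure code and the static parameters -/

section Code

variable {N K : ℕ} {F : Type uF} {V : Type uV} {W : Fin N → Type uW}
  [Field F] [AddCommGroup V] [Module F V] [∀ i, AddCommGroup (W i)] [∀ i, Module F (W i)]

/-- `T` is a recovery set of object `k`: the value of object `k` is a function of the codeword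
symbols at the servers in `T`. -/
def IsRecoverySet (Φ : ∀ i : Fin N, (Fin K → V) →ₗ[F] W i) (k : Fin K) (T : Finset (Fin N)) :
    Prop :=
  ∃ ψ : (∀ j : T, W j) → V, ∀ x : Fin K → V, ψ (fun j => Φ j x) = x k

/-- `k ∈ 𝒳_s`: the encoding function of server `s` depends on object `k`. -/
def StoresObject (Φ : ∀ i : Fin N, (Fin K → V) →ₗ[F] W i) (s : Fin N) (k : Fin K) : Prop :=
  ∃ x x' : Fin K → V, (∀ m, m ≠ k → x m = x' m) ∧ Φ s x ≠ Φ s x'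

/-- `g` is a re-encoding function `Γ_{i,k}` for server `i` and object `k`. -/
def IsReencoding (Φ : ∀ i : Fin N, (Fin K → V) →ₗ[F] W i) (i : Fin N) (k : Fin K)
    (g : W i → V → V → W i) : Prop :=
  ∀ x x' : Fin K → V, (∀ m, m ≠ k → x m = x' m) →
    g (Φ i x) (x k) (x' k) = Φ i x' ∧
    g (Φ i x) 0 (x' k - x k) = Φ i x' ∧
    g (Φ i x) (x k - x' k) 0 = Φ i x'

end Code

/-- What an instance of the algorithm is parametrized by: a linear code with encoding functions
`Φ`, some re-encoding functions `Γ` and some decoding functions `Ψ` for it (such functions exist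
for every linear code), and the clients with their identifiers and their servers. -/
structure Params (N K : ℕ) (F : Type uF) (V : Type uV) (W : Fin N → Type uW) (C : Type uC)
    [Field F] [AddCommGroup V] [Module F V] [∀ i, AddCommGroup (W i)] [∀ i, Module F (W i)] where
  /-- encoding functions -/
  Φ : ∀ i : Fin N, (Fin K → V) →ₗ[F] W i
  /-- re-encoding functions -/
  Γ : ∀ i : Fin N, Fin K → W i → V → V → W i
  isReencoding : ∀ i k, IsReencoding Φ i k (Γ i k)
  /-- decoding functions; only their values at recovery sets matter -/
  Ψ : ∀ (_ : Fin K) (T : Finset (Fin N)), (∀ j : T, W j) → V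
  decodes : ∀ k T, IsRecoverySet Φ k T → ∀ x : Fin K → V, Ψ k T (fun j => Φ j x) = x k
  /-- `home c = s` means that client `c` belongs to `𝒞_s` -/
  home : C → Fin N
  /-- the identifier of a client -/
  cid : C → ℕ
  cid_injective : Function.Injective cid

/-! ### Tags -/

/-- A tag is a vector clock value together with a client identifier. -/
structure Tag (N : ℕ) where
  ts : Fin N → ℕ
  id : ℕ

instance (N : ℕ) : Zero (Tag N) := ⟨⟨0, 0⟩⟩

/-- Vector clocks are compared componentwise; tags with incomparable (or equal) vector clocks are
compared by the client identifiers. This comparison is not transitive in general. -/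
instance (N : ℕ) : LT (Tag N) :=
  ⟨fun a b => a.ts < b.ts ∨ (¬ b.ts < a.ts ∧ a.id < b.id)⟩

instance (N : ℕ) : LE (Tag N) := ⟨fun a b => a = b ∨ a < b⟩

/-- `t = max A`. Because the comparison of tags need not be transitive, a set `A` of tags may lack
a highest element; then `t` may be any element of `A`. -/
def IsMaxTag {N : ℕ} (A : Set (Tag N)) (t : Tag N) : Prop :=
  t ∈ A ∧ ((∃ m ∈ A, ∀ a ∈ A, a ≤ m) → ∀ a ∈ A, a ≤ t)

/-- `q` is the highest tagged entry of the list `l`, and `none` if the list is empty. -/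
def IsHighestTagged {N : ℕ} {V : Type uV} (l : Set (Tag N × V)) : Option (Tag N × V) → Prop
  | none => l = ∅
  | some p => p ∈ l ∧ IsMaxTag {t | ∃ v, (t, v) ∈ l} p.1

/-! ### Messages and states -/

/-- The operations that clients can invoke. -/
inductive Op (K : ℕ) (V : Type uV) where
  | write (X : Fin K) (v : V)
  | read (X : Fin K)

/-- The responses of a server to a client. -/
inductive Resp (V : Type uV) (I : Type uI) where
  | writeAck (o : I)
  | readReturn (o : I) (v : V)

/-- The response belongs to the operation with identifier `o`. -/
def Resp.Answers {K : ℕ} {V : Type uV} {I : Type uI} (o : I) : Op K V → Resp V I → Prop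
  | .write _ _, r => r = .writeAck o
  | .read _, r => ∃ v, r = .readReturn o v

/-- A codeword symbol together with a tag for every object. -/
structure Symbol (N K : ℕ) (w : Type uW) where
  val : w
  tagvec : Fin K → Tag N

/-- The messages that server `i` sends to other servers. In `valInq`, `valResp` and
`valRespEncoded` the client `none` is `localhost`. -/
inductive Msg {N : ℕ} (K : ℕ) (V : Type uV) (W : Fin N → Type uW) (C : Type uC) (I : Type uI)
    (i : Fin N) where
  | app (X : Fin K) (v : V) (t : Tag N)
  | del (X : Fin K) (t : Tag N)
  | valInq (client : Option C) (o : I) (X : Fin K) (wanted : Fin K → Tag N)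
  | valResp (X : Fin K) (v : V) (client : Option C) (o : I) (requested : Fin K → Tag N)
  | valRespEncoded (m : Symbol N K (W i)) (client : Option C) (o : I) (X : Fin K)
      (requested : Fin K → Tag N)

/-- An entry of the list of pending reads. The client `none` is `localhost`, and `none` in `syms`
is `⊥`. -/
@[ext] structure ReadEntry {N : ℕ} (K : ℕ) (W : Fin N → Type uW) (C : Type uC) (I : Type uI) where
  client : Option C
  opid : I
  obj : Fin K
  tagvec : Fin K → Tag N
  syms : ∀ i : Fin N, Option (W i)

/-- The state variables of server `s`. -/
structure ServerState {N : ℕ} (K : ℕ) (V : Type uV) (W : Fin N → Type uW) (C : Type uC)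
    (I : Type uI) (s : Fin N) where
  vc : Fin N → ℕ
  inQueue : Set (Fin N × Fin K × V × Tag N)
  L : Fin K → Set (Tag N × V)
  delL : Fin K → Set (Tag N × Fin N)
  M : Symbol N K (W s)
  readL : Set (ReadEntry K W C I)
  error1 : Fin K → Bool
  error2 : Fin K → Bool
  tmax : Fin K → Tag N

/-- What a transition of server `s` can change: its state, the contents of its outgoing channels
`c_{s → j}`, the responses in transit to the clients, and the set of the operation identifiers
that have been used. -/
structure Loc {N : ℕ} (K : ℕ) (V : Type uV) (W : Fin N → Type uW) (C : Type uC)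
    (I : Type uI) (s : Fin N) where
  st : ServerState K V W C I s
  out : Fin N → List (Msg K V W C I s)
  resps : C → Set (Resp V I)
  used : Set I

/-- A state of the whole system. The channels between servers are first-in-first-out queues, with
the oldest message at the head of the list. The messages between a client and its server are kept
in the sets `reqs` and `resps`. -/
structure Config {N : ℕ} (K : ℕ) (V : Type uV) (W : Fin N → Type uW) (C : Type uC)
    (I : Type uI) where
  srv : ∀ s : Fin N, ServerState K V W C I s
  chan : ∀ i : Fin N, Fin N → List (Msg K V W C I i)
  reqs : C → Set (I × Op K V)
  resps : C → Set (Resp V I)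
  pending : C → Option (I × Op K V)
  used : Set I
  haltedServers : Set (Fin N)
  haltedClients : Set C

/-! ### The server protocol -/

section Protocol

variable {N K : ℕ} {F : Type uF} {V : Type uV} {W : Fin N → Type uW} {C : Type uC} {I : Type uI}
  [Field F] [AddCommGroup V] [Module F V] [∀ i, AddCommGroup (W i)] [∀ i, Module F (W i)]

/-- Send `m` to every node other than `s` that satisfies `P`. -/
def Loc.send {s : Fin N} (a : Loc K V W C I s) (P : Fin N → Prop) (m : Msg K V W C I s) :
    Loc K V W C I s :=
  { a with out := fun j => if j ≠ s ∧ P j then a.out j ++ [m] else a.out j }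

/-- Send the response `r` to client `c`. -/
def Loc.reply {s : Fin N} (a : Loc K V W C I s) (c : C) (r : Resp V I) : Loc K V W C I s :=
  { a with resps := Function.update a.resps c (a.resps c ∪ {r}) }

/-- Send `read-return` with value `v` for every entry in `D` that belongs to a client, and remove
the entries in `D` from the list of pending reads. -/
def Loc.clearReads {s : Fin N} (a : Loc K V W C I s) (D : Set (ReadEntry K W C I)) (v : V) :
    Loc K V W C I s :=
  { a with
    st := { a.st with readL := a.st.readL \ D }
    resps := fun c => a.resps c ∪
      {r | ∃ e ∈ a.st.readL ∩ D, e.client = some c ∧ r = .readReturn e.opid v} }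

/-- Add `(t, v)` to the list of object `X`. -/
def ServerState.addToL {s : Fin N} (σ : ServerState K V W C I s) (X : Fin K) (t : Tag N) (v : V) :
    ServerState K V W C I s :=
  { σ with L := Function.update σ.L X (σ.L X ∪ {(t, v)}) }

/-- The vector of codeword symbols with `w` at server `s` and `⊥` elsewhere. -/
def onlyAt (s : Fin N) (w : W s) : ∀ i : Fin N, Option (W i) :=
  Function.update (fun _ => none) s (some w)

/-- `T` is a recovery set of object `k`, the symbols at `T` are all present in `w`, and `v` is the
value that is decoded from them. -/
def Params.Decode (P : Params N K F V W C) (k : Fin K) (T : Finset (Fin N))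
    (w : ∀ i : Fin N, Option (W i)) (v : V) : Prop :=
  IsRecoverySet P.Φ k T ∧ ∃ u : ∀ j : T, W j, (∀ j : T, w j = some (u j)) ∧ v = P.Ψ k T u

/-- The iterations of a loop over a list of objects, one after the other. -/
inductive Loop {σ : Type*} (step : Fin K → σ → σ → Prop) : List (Fin K) → σ → σ → Prop
  | nil (a : σ) : Loop step [] a a
  | cons {X : Fin K} {l : List (Fin K)} {a b c : σ} :
      step X a b → Loop step l b c → Loop step (X :: l) a c

/-- A loop over all objects, each taken once, in an arbitrary order. -/
def ForEach {σ : Type*} (step : Fin K → σ → σ → Prop) (a b : σ) : Prop :=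
  ∃ l : List (Fin K), l.Nodup ∧ (∀ X, X ∈ l) ∧ Loop step l a b

variable (P : Params N K F V W C) (s : Fin N)

/-- On receipt of `write(o, X, v)` from client `c`. -/
def onWrite (c : C) (o : I) (X : Fin K) (v : V) (a b : Loc K V W C I s) : Prop :=
  let vc' := Function.update a.st.vc s (a.st.vc s + 1)
  let t : Tag N := ⟨vc', P.cid c⟩
  let a₁ : Loc K V W C I s := { a with st := { a.st with vc := vc' }.addToL X t v }
  b = ((a₁.reply c (.writeAck o)).send (fun _ => True) (.app X v t)).clearReads
        {e | e.client ≠ none ∧ e.obj = X} v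

/-- On receipt of `read(o, X)` from client `c`. -/
def onRead (c : C) (o : I) (X : Fin K) (a b : Loc K V W C I s) : Prop :=
  ∃ q, IsHighestTagged (a.st.L X) q ∧
    if ∃ p, q = some p ∧ a.st.M.tagvec X ≤ p.1 then
      ∃ p, q = some p ∧ b = a.reply c (.readReturn o p.2)
    else if IsRecoverySet P.Φ X {s} then
      ∃ v, P.Decode X {s} (onlyAt s a.st.M.val) v ∧ b = a.reply c (.readReturn o v)
    else
      b = Loc.send
        { a with st := { a.st with
            readL := a.st.readL ∪ {⟨some c, o, X, a.st.M.tagvec, onlyAt s a.st.M.val⟩} } }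
        (fun _ => True) (.valInq (some c) o X a.st.M.tagvec)

/-- On receipt of a request of client `c`. -/
def onRequest (c : C) (o : I) : Op K V → Loc K V W C I s → Loc K V W C I s → Prop
  | .write X v => onWrite P s c o X v
  | .read X => onRead P s c o X

/-- One iteration, for object `X`, of the loop that prepares the answer to a `val_inq` message. -/
def responseStep (σ : ServerState K V W C I s) (wanted : Fin K → Tag N) (X : Fin K)
    (r r' : Symbol N K (W s)) : Prop :=
  if StoresObject P.Φ s X ∧ σ.M.tagvec X ≠ wanted X ∧ (∃! v, (σ.M.tagvec X, v) ∈ σ.L X) then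
    ∃ v, (σ.M.tagvec X, v) ∈ σ.L X ∧
      if ∃! w, (wanted X, w) ∈ σ.L X then
        ∃ w, (wanted X, w) ∈ σ.L X ∧
          r' = ⟨P.Γ s X (P.Γ s X r.val v 0) 0 w, Function.update r.tagvec X (wanted X)⟩
      else
        r' = ⟨P.Γ s X r.val v 0, Function.update r.tagvec X 0⟩
  else r' = r

/-- On receipt of `val_inq` from node `j`. -/
def onValInq (j : Fin N) (client : Option C) (o : I) (X : Fin K) (wanted : Fin K → Tag N)
    (a b : Loc K V W C I s) : Prop :=
  if ∃ v, (wanted X, v) ∈ a.st.L X then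
    ∃ v, (wanted X, v) ∈ a.st.L X ∧ b = a.send (fun i => i = j) (.valResp X v client o wanted)
  else
    ∃ r, ForEach (responseStep P s a.st wanted) a.st.M r ∧
      b = a.send (fun i => i = j) (.valRespEncoded r client o X wanted)

/-- On receipt of `val_resp`. -/
def onValResp (X : Fin K) (v : V) (client : Option C) (o : I) (requested : Fin K → Tag N)
    (a b : Loc K V W C I s) : Prop :=
  if ∃ w, (⟨client, o, X, requested, w⟩ : ReadEntry K W C I) ∈ a.st.readL then
    ∃ w, (⟨client, o, X, requested, w⟩ : ReadEntry K W C I) ∈ a.st.readL ∧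
      let σ : ServerState K V W C I s :=
        { a.st with readL := a.st.readL \ {⟨client, o, X, requested, w⟩} }
      match client with
      | none => b = { a with st := σ.addToL X (requested X) v }
      | some c => b = Loc.reply { a with st := σ } c (.readReturn o v)
  else b = a

/-- The variables changed by the loop that modifies a codeword symbol received from node `j`. -/
structure Modif (K : ℕ) (w : Type uW) where
  codeword : w
  error1 : Fin K → Bool
  error2 : Fin K → Bool

/-- One iteration, for object `X`, of the loop that modifies the codeword symbol `m` received from
node `j`: first remove the version of `X` in it, then insert the requested version. -/
def modifyStep (σ : ServerState K V W C I s) (j : Fin N) (m : Symbol N K (W j))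
    (requested : Fin K → Tag N) (X : Fin K) (r r' : Modif K (W j)) : Prop :=
  if StoresObject P.Φ j X ∧ requested X ≠ m.tagvec X then
    ∃ r₁ : Modif K (W j),
      (if m.tagvec X ≠ 0 ∧ (∃! w, (m.tagvec X, w) ∈ σ.L X) then
        ∃ w, (m.tagvec X, w) ∈ σ.L X ∧ r₁ = { r with codeword := P.Γ j X r.codeword w 0 }
      else if m.tagvec X ≠ 0 then
        r₁ = { r with error1 := Function.update r.error1 X true }
      else r₁ = r) ∧
      (if r₁.error1 X = false ∧ (∃! v, (requested X, v) ∈ σ.L X) then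
        ∃ v, (requested X, v) ∈ σ.L X ∧ r' = { r₁ with codeword := P.Γ j X r₁.codeword 0 v }
      else r' = { r₁ with error2 := Function.update r₁.error2 X true })
  else r' = r

/-- On receipt of `val_resp_encoded` with codeword symbol `m` from node `j`. -/
def onValRespEncoded (j : Fin N) (m : Symbol N K (W j)) (client : Option C) (o : I) (X : Fin K)
    (requested : Fin K → Tag N) (a b : Loc K V W C I s) : Prop :=
  if ∃ w, (⟨client, o, X, requested, w⟩ : ReadEntry K W C I) ∈ a.st.readL then
    ∃ w, (⟨client, o, X, requested, w⟩ : ReadEntry K W C I) ∈ a.st.readL ∧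
    ∃ r : Modif K (W j),
      ForEach (modifyStep P s a.st j m requested)
        ⟨m.val, fun _ => false, fun _ => false⟩ r ∧
      let σ : ServerState K V W C I s := { a.st with error1 := r.error1, error2 := r.error2 }
      if ∀ Y, r.error1 Y = false ∧ r.error2 Y = false then
        let w' := Function.update w j (some r.codeword)
        if ∃ T v, P.Decode X T w' v then
          ∃ T v, P.Decode X T w' v ∧
            let σ' : ServerState K V W C I s :=
              { σ with readL := {e ∈ σ.readL | ¬ (e.client = client ∧ e.opid = o ∧ e.obj = X ∧
                  e.tagvec = requested)} }
            match client with
            | none => b = { a with st := σ'.addToL X (σ'.M.tagvec X) v }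
            | some c => b = Loc.reply { a with st := σ' } c (.readReturn o v)
        else
          b = { a with st := { σ with readL :=
                  (σ.readL \ {⟨client, o, X, requested, w⟩}) ∪
                    {⟨client, o, X, requested, w'⟩} } }
      else b = { a with st := σ }
  else b = { a with st := { a.st with error1 := fun _ => false, error2 := fun _ => false } }

/-- On receipt of a message from node `j`. -/
def onMsg (j : Fin N) : Msg K V W C I j → Loc K V W C I s → Loc K V W C I s → Prop
  | .app X v t => fun a b =>
      b = { a with st := { a.st with inQueue := a.st.inQueue ∪ {(j, X, v, t)} } }
  | .del X t => fun a b =>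
      b = { a with st := { a.st with
              delL := Function.update a.st.delL X (a.st.delL X ∪ {(t, j)}) } }
  | .valInq client o X wanted => onValInq P s j client o X wanted
  | .valResp X v client o requested => onValResp s X v client o requested
  | .valRespEncoded m client o X requested => onValRespEncoded P s j m client o X requested

/-- The internal action `Apply_InQueue`. The head of the queue is an entry with a minimal
timestamp, ties being broken arbitrarily. -/
def applyInQueue (a b : Loc K V W C I s) : Prop :=
  ∃ (j : Fin N) (X : Fin K) (v : V) (t : Tag N),
    (j, X, v, t) ∈ a.st.inQueue ∧ (∀ q ∈ a.st.inQueue, ¬ q.2.2.2.ts < t.ts) ∧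
    if (∀ p, p ≠ j → t.ts p ≤ a.st.vc p) ∧ t.ts j = a.st.vc j + 1 then
      let a₁ : Loc K V W C I s :=
        { a with st := { a.st with
            inQueue := a.st.inQueue \ {(j, X, v, t)}
            vc := Function.update a.st.vc j (t.ts j) }.addToL X t v }
      b = a₁.clearReads
        {e | e.obj = X ∧ ((e.client ≠ none ∧ e.tagvec X ≤ t) ∨
          (e.client = none ∧ e.tagvec X = t))} v
    else b = a

/-- The tags `t` of object `X` such that every node that stores `X` is known to have sent `del`
with a tag at least `t`. -/
def deletedAtStores (σ : ServerState K V W C I s) (X : Fin K) : Set (Tag N) :=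
  {t | ∀ i, StoresObject P.Φ i X → ∃ t', (t', i) ∈ σ.delL X ∧ t ≤ t'}

/-- The first part of `Encoding`, for an object `X ∈ 𝒳_s`. -/
def encodeStored (X : Fin K) (a b : Loc K V W C I s) : Prop :=
  ∃ q, IsHighestTagged (a.st.L X) q ∧
    if StoresObject P.Φ s X ∧ ∃ p, q = some p ∧ a.st.M.tagvec X < p.1 then
      ∃ p, q = some p ∧
        if ∃ val, (a.st.M.tagvec X, val) ∈ a.st.L X then
          ∃ val v, (a.st.M.tagvec X, val) ∈ a.st.L X ∧ (p.1, v) ∈ a.st.L X ∧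
            b = Loc.send
              { a with st := { a.st with
                  M := ⟨P.Γ s X a.st.M.val val v, Function.update a.st.M.tagvec X p.1⟩
                  delL := Function.update a.st.delL X (a.st.delL X ∪ {(p.1, s)}) } }
              (fun i => StoresObject P.Φ i X) (.del X p.1)
        else if ∃ e ∈ a.st.readL, e.client = none ∧ e.obj = X ∧
            e.tagvec X = a.st.M.tagvec X then
          b = a
        else
          ∃ o, o ∉ a.used ∧
            b = Loc.send
              { a with
                st := { a.st with readL := a.st.readL ∪
                    {⟨none, o, X, a.st.M.tagvec, onlyAt s a.st.M.val⟩} }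
                used := a.used ∪ {o} }
              (fun _ => True) (.valInq none o X a.st.M.tagvec)
    else b = a

/-- The second part of `Encoding`, for an object `X ∉ 𝒳_s`. -/
def encodeNotStored (X : Fin K) (a b : Loc K V W C I s) : Prop :=
  ∃ q, IsHighestTagged (a.st.L X) q ∧
    let U' := deletedAtStores P s a.st X ∩
      {t | (∃ val, (t, val) ∈ a.st.L X) ∧ a.st.M.tagvec X < t}
    if ¬ StoresObject P.Φ s X ∧ (∃ p, q = some p ∧ a.st.M.tagvec X < p.1) ∧ U'.Nonempty then
      ∃ t, IsMaxTag U' t ∧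
        b = Loc.send
          { a with st := { a.st with
              M := ⟨a.st.M.val, Function.update a.st.M.tagvec X t⟩
              delL := Function.update a.st.delL X (a.st.delL X ∪ {(t, s)}) } }
          (fun _ => True) (.del X t)
    else b = a

/-- The internal action `Encoding`. -/
def encoding (a b : Loc K V W C I s) : Prop :=
  ∃ a₁, ForEach (encodeStored P s) a a₁ ∧ ForEach (encodeNotStored P s) a₁ b

/-- The internal action `Garbage_Collection`, for object `X`. -/
def collectStep (X : Fin K) (a b : Loc K V W C I s) : Prop :=
  ∃ q tm, IsHighestTagged (a.st.L X) q ∧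
    let S : Set (Tag N) := {t | ∀ i, ∃ t', (t', i) ∈ a.st.delL X ∧ t ≤ t'}
    let S' : Set (Tag N) := {t | ∀ i, (t, i) ∈ a.st.delL X}
    let m := a.st.M.tagvec X
    let T : Set (Tag N) := {t | ∃ e ∈ a.st.readL, e.tagvec X = t ∧ t < m}
    let U := deletedAtStores P s a.st X
    (if S.Nonempty then IsMaxTag S tm else tm = a.st.tmax X) ∧
    let D : Set (Tag N × V) :=
      if tm = m ∧ m ∈ S' ∧ (∀ p, q = some p → p.1 ≤ m) then
        {p | p.1 ≤ tm ∧ p.1 ∉ T}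
      else if tm < m ∧ ¬ StoresObject P.Φ s X then
        {p | p.1 ≤ tm ∧ p.1 ∉ T}
      else {p | p.1 < tm ∧ p.1 ∉ T}
    let a₁ : Loc K V W C I s :=
      { a with st := { a.st with
          tmax := Function.update a.st.tmax X tm
          L := Function.update a.st.L X (a.st.L X \ D) } }
    if U.Nonempty ∧ StoresObject P.Φ s X then
      ∃ u, IsMaxTag U u ∧ b = a₁.send (fun _ => True) (.del X u)
    else b = a₁

/-- The internal action `Garbage_Collection`. -/
def garbageCollection (a b : Loc K V W C I s) : Prop :=
  ForEach (collectStep P s) a b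

end Protocol

/-! ### The composed system and its executions -/

section System

variable {N K : ℕ} {F : Type uF} {V : Type uV} {W : Fin N → Type uW} {C : Type uC} {I : Type uI}
  [Field F] [AddCommGroup V] [Module F V] [∀ i, AddCommGroup (W i)] [∀ i, Module F (W i)]

/-- The part of the system state that transitions of server `s` can change. -/
def Config.view (γ : Config K V W C I) (s : Fin N) : Loc K V W C I s :=
  ⟨γ.srv s, γ.chan s, γ.resps, γ.used⟩

/-- Write back the part of the system state that belongs to server `s`. -/
def Config.put (γ : Config K V W C I) (s : Fin N) (a : Loc K V W C I s) : Config K V W C I :=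
  { γ with
    srv := Function.update γ.srv s a.st
    chan := Function.update γ.chan s a.out
    resps := a.resps
    used := a.used }

/-- The initial state of server `s`. -/
def ServerState.initial (s : Fin N) : ServerState K V W C I s where
  vc := 0
  inQueue := ∅
  L := fun _ => {(0, 0)}
  delL := fun _ => ∅
  M := ⟨0, fun _ => 0⟩
  readL := ∅
  error1 := fun _ => false
  error2 := fun _ => false
  tmax := fun _ => 0

/-- The initial state of the system. -/
def Config.initial : Config K V W C I where
  srv := fun s => ServerState.initial s
  chan := fun _ _ => []
  reqs := fun _ => ∅
  resps := fun _ => ∅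
  pending := fun _ => none
  used := ∅
  haltedServers := ∅
  haltedClients := ∅

/-- The actions of the system. -/
inductive Action (N K : ℕ) (V : Type uV) (C : Type uC) (I : Type uI) where
  /-- client `c` gets an invocation and sends the request to its server -/
  | invoke (c : C) (o : I) (op : Op K V)
  /-- the server of client `c` receives a request of `c` -/
  | request (c : C) (o : I) (op : Op K V)
  /-- server `s` receives the next message from server `i` -/
  | receive (i s : Fin N)
  | applyInQueue (s : Fin N)
  | encoding (s : Fin N)
  | garbageCollection (s : Fin N)
  /-- client `c` receives a response of its server, which completes the pending operation if it
  belongs to it -/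
  | respond (c : C) (r : Resp V I)
  | haltServer (s : Fin N)
  | haltClient (c : C)

/-- The transitions of the system. A client has at most one pending operation, and every operation
has a fresh identifier. -/
def Step (P : Params N K F V W C) (γ : Config K V W C I) :
    Action N K V C I → Config K V W C I → Prop
  | .invoke c o op, γ' =>
      c ∉ γ.haltedClients ∧ γ.pending c = none ∧ o ∉ γ.used ∧
      γ' = { γ with
        pending := Function.update γ.pending c (some (o, op))
        reqs := Function.update γ.reqs c (γ.reqs c ∪ {(o, op)})
        used := γ.used ∪ {o} }
  | .request c o op, γ' =>
      P.home c ∉ γ.haltedServers ∧ (o, op) ∈ γ.reqs c ∧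
      ∃ b, onRequest P (P.home c) c o op (γ.view (P.home c)) b ∧
        γ' = Config.put
          { γ with reqs := Function.update γ.reqs c (γ.reqs c \ {(o, op)}) } (P.home c) b
  | .receive i s, γ' =>
      s ∉ γ.haltedServers ∧ i ≠ s ∧
      ∃ m rest b, γ.chan i s = m :: rest ∧ onMsg P s i m (γ.view s) b ∧
        γ' = Config.put
          { γ with chan := Function.update γ.chan i (Function.update (γ.chan i) s rest) } s b
  | .applyInQueue s, γ' =>
      s ∉ γ.haltedServers ∧ ∃ b, applyInQueue s (γ.view s) b ∧ γ' = γ.put s b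
  | .encoding s, γ' =>
      s ∉ γ.haltedServers ∧ ∃ b, encoding P s (γ.view s) b ∧ γ' = γ.put s b
  | .garbageCollection s, γ' =>
      s ∉ γ.haltedServers ∧ ∃ b, garbageCollection P s (γ.view s) b ∧ γ' = γ.put s b
  | .respond c r, γ' =>
      c ∉ γ.haltedClients ∧ r ∈ γ.resps c ∧
      γ' = { γ with
        resps := Function.update γ.resps c (γ.resps c \ {r})
        pending := if ∃ o op, γ.pending c = some (o, op) ∧ r.Answers o op then
            Function.update γ.pending c none else γ.pending }
  | .haltServer s, γ' => γ' = { γ with haltedServers := γ.haltedServers ∪ {s} }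
  | .haltClient c, γ' => γ' = { γ with haltedClients := γ.haltedClients ∪ {c} }

/-- A finite or infinite execution: `state 0, act 0, state 1, act 1, …` with `len` actions. The
values `act i` for `i ≥ len` and `state i` for `i > len` are not part of the execution. -/
structure Execution (P : Params N K F V W C) (I : Type uI) where
  len : ℕ∞
  state : ℕ → Config K V W C I
  act : ℕ → Action N K V C I
  init_eq : state 0 = Config.initial
  step : ∀ i : ℕ, (i : ℕ∞) < len → Step P (state i) (act i) (state (i + 1))

/-! ### Operations, timestamps and causal consistency -/

variable {P : Params N K F V W C}

/-- An invocation that occurs in the execution. -/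
structure Invocation (β : Execution P I) where
  idx : ℕ
  client : C
  opid : I
  op : Op K V
  idx_lt : (idx : ℕ∞) < β.len
  act_eq : β.act idx = .invoke client opid op

/-- The operations of an execution are those that clients invoke and, for every object, an initial
write of the initial value `0`. -/
inductive Operation (β : Execution P I) where
  | initial (X : Fin K)
  | invoked (π : Invocation β)

variable {β : Execution P I}

/-- `π` is a write of `v` to object `X`. -/
def Operation.IsWrite : Operation β → Fin K → V → Prop
  | .initial Y, X, v => Y = X ∧ v = 0
  | .invoked π, X, v => π.op = .write X v

/-- `π` is a read of object `X`. -/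
def Operation.IsRead : Operation β → Fin K → Prop
  | .initial _, _ => False
  | .invoked π, X => π.op = .read X

/-- The read `π` completes in the execution and returns `v`. -/
def Operation.Returns : Operation β → V → Prop
  | .initial _, _ => False
  | .invoked π, v => (∃ X, π.op = .read X) ∧ ∃ n : ℕ, (n : ℕ∞) < β.len ∧
      (β.state n).pending π.client = some (π.opid, π.op) ∧
      β.act n = .respond π.client (.readReturn π.opid v)

/-- At point `n` a response to `π` is in transit to the client. -/
def Invocation.ResponseAt (π : Invocation β) (n : ℕ) : Prop :=
  ∃ r ∈ (β.state n).resps π.client, r.Answers π.opid π.op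

/-- `π` has the timestamp `T`: the vector clock of the server of the client at the first point at
which this server has sent a response to `π`. Initial writes have timestamp `0`. -/
def Operation.HasTimestamp : Operation β → (Fin N → ℕ) → Prop
  | .initial _, T => T = 0
  | .invoked π, T => ∃ n : ℕ, (n : ℕ∞) ≤ β.len ∧ π.ResponseAt n ∧ (∀ m < n, ¬ π.ResponseAt m) ∧
      T = ((β.state n).srv (P.home π.client)).vc

/-- The program order `π₁ → π₂`: both are invoked by the same client, and `π₁` comes first. -/
def ProgramOrder : Operation β → Operation β → Prop
  | .invoked π₁, .invoked π₂ => π₁.client = π₂.client ∧ π₁.idx < π₂.idx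
  | _, _ => False

/-- The order `π₁ ⇝ π₂` built from the timestamps. -/
def TimestampOrder (π₁ π₂ : Operation β) : Prop :=
  (∃ T₁ T₂, π₁.HasTimestamp T₁ ∧ π₂.HasTimestamp T₂ ∧ T₁ < T₂) ∨
  (∃ T, π₁.HasTimestamp T ∧ π₂.HasTimestamp T ∧ (∃ X v, π₁.IsWrite X v) ∧ ∃ X, π₂.IsRead X) ∨
  (∃ T, π₁.HasTimestamp T ∧ π₂.HasTimestamp T ∧ (∃ X, π₁.IsRead X) ∧ (∃ X, π₂.IsRead X) ∧
    ProgramOrder π₁ π₂) ∨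
  ((∃ T, π₁.HasTimestamp T) ∧ ¬ ∃ T, π₂.HasTimestamp T)

/-- With respect to the order `r`, the read `π` of object `X` that returns `v` reads from the write
`φ`: `φ` precedes `π`, writes `v` to `X`, and no other write of `v` to `X` lies between them. -/
def ReadsFrom (r : Operation β → Operation β → Prop) (π : Operation β) (X : Fin K) (v : V)
    (φ : Operation β) : Prop :=
  r φ π ∧ φ.IsWrite X v ∧ ∀ ω, r φ ω → r ω π → ¬ ω.IsWrite X v

/-- The partial order `r` on the operations witnesses that the execution is causally consistent. -/
structure IsCausalOrder (r : Operation β → Operation β → Prop) : Prop where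
  isStrictOrder : IsStrictOrder (Operation β) r
  programOrder : ∀ π₁ π₂, ProgramOrder π₁ π₂ → r π₁ π₂
  reads : ∀ π X v, π.IsRead X → π.Returns v → ∃! φ, ReadsFrom r π X v φ

/-- Causal consistency of an execution. -/
def CausallyConsistent (β : Execution P I) : Prop :=
  ∃ r : Operation β → Operation β → Prop, IsCausalOrder r

end System

end CausalEC

end

section

open Classical

namespace CausalEC

universe uF uV uW uC uI

set_option linter.unusedSectionVars false

/-! ### Local correctness: the code, tagged versions, and the loops that recode symbols. -/

section Local

variable {N K : ℕ} {F : Type uF} {V : Type uV} {W : Fin N → Type uW} {C : Type uC} {I : Type uI}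
  [Field F] [AddCommGroup V] [Module F V] [∀ i, AddCommGroup (W i)] [∀ i, Module F (W i)]

/-! ### The code -/

/-! The argument attaches to an execution a growing ghost relation `versions`, saying which value
each tag of each object stands for. Only write requests extend it. A new tag is fresh because its
component at the writing server is one more than that server's own clock component, and that
component bounds the corresponding one of every existing tag. Hence a tag determines a value.

The safety invariant says that everything stored or in transit agrees with this relation: list
entries, queue entries and messages carry true versions, every codeword symbol encodes the versions
named by its tags, and all symbols collected for one pending read encode the same data vector, the
one it requested. Removing a version with `Γ` and inserting another is then exact, so decoding
returns a true version (`modifyLoop_codeword`, `onValRespEncoded_effect`). Tags on which a server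
can base an answer also have timestamps below its clock. The delicate point is an internal read,
whose decoded value is stored under the current tag of the local symbol instead of the requested
one. The two agree because that tag cannot change while an internal read of the object is pending:
changing it needs the very list entry whose absence caused the read. Choices of a highest tag affect
safety only through membership, so the failure of transitivity for tags does no harm, and garbage
collection is harmless because the invariant never requires a list entry to exist.

Consequently a read is answered with a version whose timestamp is at most that of the read
(`exists_write_of_returns`), while a write strictly raises the clock of its server. With monotone
clocks and one pending operation per client, program order is contained in the timestamp order
(`timestampOrder_of_programOrder`).

For unique sources, the timestamp order is extended to `KeyOrder`, which compares the sum of the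
timestamp and then a rank. Writes of the same value to the same object that have timestamps are
comparable there unless equal, so a read has at most one source. A source exists because a suitable
measure on the preceding writes decreases upwards (`exists_readsFrom`). -/

theorem Params.reencode (P : Params N K F V W C) (i : Fin N) (k : Fin K) (x : Fin K → V) (v : V) :
    P.Γ i k (P.Φ i x) (x k) v = P.Φ i (Function.update x k v) := by
  have h := (P.isReencoding i k x (Function.update x k v)
    (fun m hm => by simp [Function.update_of_ne hm])).1
  simpa using h

theorem encode_update_of_not_stores {Φ : ∀ i : Fin N, (Fin K → V) →ₗ[F] W i} {s : Fin N}
    {k : Fin K} (h : ¬ StoresObject Φ s k) (x : Fin K → V) (v : V) :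
    Φ s (Function.update x k v) = Φ s x := by
  by_contra hne
  exact h ⟨_, _, fun m hm => by simp [Function.update_of_ne hm], hne⟩

/-- Decoding is sound as soon as all symbols that are present encode one common vector; which
recovery set is chosen is then irrelevant. -/
theorem Params.Decode.eq {P : Params N K F V W C} {k : Fin K} {T : Finset (Fin N)}
    {w : ∀ i : Fin N, Option (W i)} {v : V} (h : P.Decode k T w v) {x : Fin K → V}
    (hx : ∀ i y, w i = some y → y = P.Φ i x) : v = x k := by
  obtain ⟨hT, u, hu, rfl⟩ := h
  have : u = fun j : T => P.Φ j x := funext fun j => hx _ _ (hu j)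
  rw [this, P.decodes k T hT x]

theorem eq_of_onlyAt {s i : Fin N} {y : W s} {w : W i} (h : onlyAt s y i = some w)
    {f : ∀ i, W i} (hy : y = f s) : w = f i := by
  by_cases hi : i = s
  · subst hi
    simp [onlyAt] at h
    rw [← h, hy]
  · simp [onlyAt, Function.update_of_ne hi] at h

/-! ### Versions of the objects -/

/-- A relation between objects, tags and values that records which version of an object a tag
stands for: the tag `0` stands for the initial value, and a tag determines the value. -/
structure IsVersioning (G : Fin K → Tag N → V → Prop) : Prop where
  zero : ∀ X, G X 0 0
  unique : ∀ {X t v w}, G X t v → G X t w → v = w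

/-- The symbol at server `j` is the encoding of the versions that its tags stand for. -/
def Encodes (P : Params N K F V W C) (G : Fin K → Tag N → V → Prop) {j : Fin N}
    (m : Symbol N K (W j)) : Prop :=
  ∃ x, m.val = P.Φ j x ∧ ∀ Y, G Y (m.tagvec Y) (x Y)

/-- The contents of a message agree with the versions `G`. -/
def MsgCorrect (P : Params N K F V W C) (G : Fin K → Tag N → V → Prop) {j : Fin N} :
    Msg K V W C I j → Prop
  | .app X v t => G X t v
  | .valResp X v _ _ requested => G X (requested X) v
  | .valRespEncoded m _ _ _ _ => Encodes P G m
  | _ => True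

/-- The state of server `s` agrees with the versions `G`. A pending internal read concerns a stored
object, asks for the version which is encoded in the local symbol, and this version is missing in
the list. -/
structure ServerCorrect (P : Params N K F V W C) (G : Fin K → Tag N → V → Prop) {s : Fin N}
    (σ : ServerState K V W C I s) : Prop where
  inQueue : ∀ {j X v t}, (j, X, v, t) ∈ σ.inQueue → G X t v
  list : ∀ {X t v}, (t, v) ∈ σ.L X → G X t v ∧ t.ts ≤ σ.vc
  symbol : Encodes P G σ.M
  symbol_le : ∀ Y, (σ.M.tagvec Y).ts ≤ σ.vc
  reads : ∀ e ∈ σ.readL, (e.tagvec e.obj).ts ≤ σ.vc ∧ ∃ x, (∀ Y, G Y (e.tagvec Y) (x Y)) ∧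
    ∀ i w, e.syms i = some w → w = P.Φ i x
  localhost : ∀ e ∈ σ.readL, e.client = none → StoresObject P.Φ s e.obj ∧
    e.tagvec e.obj = σ.M.tagvec e.obj ∧ ∀ v, (σ.M.tagvec e.obj, v) ∉ σ.L e.obj
  localhost_unique : ∀ e ∈ σ.readL, ∀ e' ∈ σ.readL, e.client = none → e'.client = none →
    e.obj = e'.obj → e = e'

theorem Encodes.mono {P : Params N K F V W C} {G G' : Fin K → Tag N → V → Prop} {j : Fin N}
    {m : Symbol N K (W j)} (h : Encodes P G m) (hG : ∀ X t v, G X t v → G' X t v) :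
    Encodes P G' m := by
  obtain ⟨x, hx, hY⟩ := h
  exact ⟨x, hx, fun Y => hG _ _ _ (hY Y)⟩

theorem MsgCorrect.mono {P : Params N K F V W C} {G G' : Fin K → Tag N → V → Prop} {j : Fin N}
    {m : Msg K V W C I j} (h : MsgCorrect P G m) (hG : ∀ X t v, G X t v → G' X t v) :
    MsgCorrect P G' m := by
  cases m with
  | app => exact hG _ _ _ h
  | valResp => exact hG _ _ _ h
  | valRespEncoded => exact Encodes.mono h hG
  | _ => trivial

theorem ServerCorrect.mono {P : Params N K F V W C} {G G' : Fin K → Tag N → V → Prop} {s : Fin N}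
    {σ : ServerState K V W C I s} (h : ServerCorrect P G σ) (hG : ∀ X t v, G X t v → G' X t v) :
    ServerCorrect P G' σ where
  inQueue hq := hG _ _ _ (h.inQueue hq)
  list hq := ⟨hG _ _ _ (h.list hq).1, (h.list hq).2⟩
  symbol := h.symbol.mono hG
  symbol_le := h.symbol_le
  reads e he := by
    obtain ⟨h₁, x, hx, hs⟩ := h.reads e he
    exact ⟨h₁, x, fun Y => hG _ _ _ (hx Y), hs⟩
  localhost := h.localhost
  localhost_unique := h.localhost_unique

theorem ServerCorrect.initial (P : Params N K F V W C) {G : Fin K → Tag N → V → Prop}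
    (hG : ∀ X, G X 0 0) (s : Fin N) :
    ServerCorrect P G (ServerState.initial s : ServerState K V W C I s) where
  inQueue hq := by simp [ServerState.initial] at hq
  list hq := by
    simp only [ServerState.initial, Set.mem_singleton_iff, Prod.mk.injEq] at hq
    obtain ⟨rfl, rfl⟩ := hq
    exact ⟨hG _, le_refl _⟩
  symbol := ⟨0, by simp [ServerState.initial], fun Y => hG Y⟩
  symbol_le Y := le_refl _
  reads e he := by simp [ServerState.initial] at he
  localhost e he := by simp [ServerState.initial] at he
  localhost_unique e he := by simp [ServerState.initial] at he

theorem mem_addToL {s : Fin N} {σ : ServerState K V W C I s} {X Y : Fin K} {t t' : Tag N}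
    {v v' : V} : (t', v') ∈ (σ.addToL X t v).L Y ↔
      (t', v') ∈ σ.L Y ∨ (Y = X ∧ t' = t ∧ v' = v) := by
  by_cases h : Y = X
  · subst h; simp [ServerState.addToL, or_comm]
  · simp [ServerState.addToL, h]

/-- Adding a correct version to a list is harmless unless a pending internal read asks for it. -/
theorem ServerCorrect.addToL {P : Params N K F V W C} {G : Fin K → Tag N → V → Prop} {s : Fin N}
    {σ : ServerState K V W C I s} (h : ServerCorrect P G σ) {X : Fin K} {t : Tag N} {v : V}
    (hG : G X t v) (ht : t.ts ≤ σ.vc)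
    (hl : ∀ e ∈ σ.readL, e.client = none → e.obj = X → σ.M.tagvec X ≠ t) :
    ServerCorrect P G (σ.addToL X t v) where
  inQueue := h.inQueue
  list hq := by
    rcases mem_addToL.1 hq with hq | ⟨rfl, rfl, rfl⟩
    exacts [h.list hq, ⟨hG, ht⟩]
  symbol := h.symbol
  symbol_le := h.symbol_le
  reads := h.reads
  localhost e he hc := by
    obtain ⟨h₁, h₂, h₃⟩ := h.localhost e he hc
    refine ⟨h₁, h₂, fun v' hv' => ?_⟩
    rcases mem_addToL.1 hv' with hv' | ⟨hX, ht', -⟩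
    · exact h₃ v' hv'
    · subst hX; exact hl e he hc rfl ht'
  localhost_unique := h.localhost_unique

theorem ServerCorrect.subset {P : Params N K F V W C} {G : Fin K → Tag N → V → Prop} {s : Fin N}
    {σ : ServerState K V W C I s} (h : ServerCorrect P G σ) {R : Set (ReadEntry K W C I)}
    (hR : R ⊆ σ.readL) : ServerCorrect P G { σ with readL := R } where
  inQueue := h.inQueue
  list := h.list
  symbol := h.symbol
  symbol_le := h.symbol_le
  reads e he := h.reads e (hR he)
  localhost e he := h.localhost e (hR he)
  localhost_unique e he f hf := h.localhost_unique e (hR he) f (hR hf)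

/-- A larger clock and a smaller queue. -/
theorem ServerCorrect.advance {P : Params N K F V W C} {G : Fin K → Tag N → V → Prop} {s : Fin N}
    {σ : ServerState K V W C I s} (h : ServerCorrect P G σ) {T : Fin N → ℕ} (hT : σ.vc ≤ T)
    {Q : Set (Fin N × Fin K × V × Tag N)} (hQ : Q ⊆ σ.inQueue) :
    ServerCorrect P G { σ with vc := T, inQueue := Q } where
  inQueue hq := h.inQueue (hQ hq)
  list hq := ⟨(h.list hq).1, (h.list hq).2.trans hT⟩
  symbol := h.symbol
  symbol_le Y := (h.symbol_le Y).trans hT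
  reads e he := ⟨(h.reads e he).1.trans hT, (h.reads e he).2⟩
  localhost := h.localhost
  localhost_unique := h.localhost_unique

/-- The error flags, the deletion lists and `tmax` do not matter. -/
theorem ServerCorrect.congr {P : Params N K F V W C} {G : Fin K → Tag N → V → Prop} {s : Fin N}
    {σ σ' : ServerState K V W C I s} (h : ServerCorrect P G σ) (h₁ : σ'.vc = σ.vc)
    (h₂ : σ'.inQueue = σ.inQueue) (h₃ : σ'.L = σ.L) (h₄ : σ'.M = σ.M) (h₅ : σ'.readL = σ.readL) :
    ServerCorrect P G σ' := by
  obtain ⟨i₁, i₂, i₃, i₄, i₅, i₆, i₇⟩ := h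
  constructor
  all_goals simp only [h₁, h₂, h₃, h₄, h₅]
  all_goals assumption

/-- Adding a pending read of a client for the versions of the local symbol. -/
theorem ServerCorrect.addRead {P : Params N K F V W C} {G : Fin K → Tag N → V → Prop} {s : Fin N}
    {σ : ServerState K V W C I s} (h : ServerCorrect P G σ) (cl : Option C) (o : I) (X : Fin K)
    (hl : cl = none → StoresObject P.Φ s X ∧ (∀ v, (σ.M.tagvec X, v) ∉ σ.L X) ∧
      ∀ e ∈ σ.readL, e.client = none → e.obj ≠ X) :
    ServerCorrect P G
      { σ with readL := σ.readL ∪ {⟨cl, o, X, σ.M.tagvec, onlyAt s σ.M.val⟩} } where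
  inQueue := h.inQueue
  list := h.list
  symbol := h.symbol
  symbol_le := h.symbol_le
  reads e he := by
    rcases he with he | rfl
    · exact h.reads e he
    · obtain ⟨x, hx, hY⟩ := h.symbol
      exact ⟨h.symbol_le _, x, hY, fun i w hw => eq_of_onlyAt (f := fun i => P.Φ i x) hw hx⟩
  localhost e he hc := by
    rcases he with he | rfl
    · exact h.localhost e he hc
    · exact ⟨(hl hc).1, rfl, (hl hc).2.1⟩
  localhost_unique e he e' he' hc hc' ho := by
    rcases he with he | rfl <;> rcases he' with he' | rfl
    · exact h.localhost_unique e he e' he' hc hc' ho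
    · exact absurd ho ((hl hc').2.2 e he hc)
    · exact absurd ho.symm ((hl hc).2.2 e' he' hc')
    · rfl

/-! ### Loops -/

theorem Loop.rel {σ : Type*} {step : Fin K → σ → σ → Prop} {R : σ → σ → Prop}
    (refl : ∀ a, R a a) (trans : ∀ a b c, R a b → R b c → R a c)
    (h : ∀ X a b, step X a b → R a b) {l : List (Fin K)} {a b : σ} (hl : Loop step l a b) :
    R a b := by
  induction hl with
  | nil a => exact refl a
  | cons hs _ ih => exact trans _ _ _ (h _ _ _ hs) ih

theorem ForEach.rel {σ : Type*} {step : Fin K → σ → σ → Prop} {R : σ → σ → Prop}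
    (refl : ∀ a, R a a) (trans : ∀ a b c, R a b → R b c → R a c)
    (h : ∀ X a b, step X a b → R a b) {a b : σ} (hl : ForEach step a b) : R a b := by
  obtain ⟨l, -, -, hl⟩ := hl
  exact hl.rel refl trans h

variable {P : Params N K F V W C} {G : Fin K → Tag N → V → Prop} {s : Fin N}

/-- The algorithm tests the tags of the stored symbol while it modifies a copy. Since no object is
visited twice, the copy still has the stored tag at every object yet to be visited, so the list
value that is removed is the one encoded in the copy. -/
theorem encodes_of_responseLoop (hG : IsVersioning G) {σ : ServerState K V W C I s}
    (h : ServerCorrect P G σ) {wanted : Fin K → Tag N} {l : List (Fin K)}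
    {r r' : Symbol N K (W s)} (hl : Loop (responseStep P s σ wanted) l r r') (hn : l.Nodup)
    (ht : ∀ X ∈ l, r.tagvec X = σ.M.tagvec X) (hr : Encodes P G r) : Encodes P G r' := by
  induction hl with
  | nil a => exact hr
  | @cons X l a b c hs _ ih =>
    rw [List.nodup_cons] at hn
    obtain ⟨x, hx, hY⟩ := hr
    have hX := ht X (by simp)
    rcases ite_prop_iff_or.1 hs with ⟨hc, hs⟩ | ⟨hc, hs⟩
    · obtain ⟨v, hv, hs⟩ := hs
      have hv' : v = x X := hG.unique (h.list hv).1 (hX ▸ hY X)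
      subst hv'
      rcases ite_prop_iff_or.1 hs with ⟨hw, hs⟩ | ⟨hw, hs⟩
      · obtain ⟨w, hw, rfl⟩ := hs
        refine ih hn.2 (fun Y hYl => ?_) ⟨Function.update x X w, ?_, fun Y => ?_⟩
        · have : Y ≠ X := fun e => hn.1 (e ▸ hYl)
          simp only [Function.update_of_ne this]
          exact ht Y (by simp [hYl])
        · have := P.reencode s X (Function.update x X 0) w
          simp only [Function.update_self, Function.update_idem] at this
          simp only [hx, P.reencode s X x 0, this]
        · by_cases e : Y = X
          · subst e; simpa using (h.list hw).1
          · simpa [Function.update_of_ne e] using hY Y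
      · subst hs
        refine ih hn.2 (fun Y hYl => ?_) ⟨Function.update x X 0, ?_, fun Y => ?_⟩
        · have : Y ≠ X := fun e => hn.1 (e ▸ hYl)
          simp only [Function.update_of_ne this]
          exact ht Y (by simp [hYl])
        · simp only [hx, P.reencode s X x 0]
        -- If only the removal happens, the copy gets tag `0` at `X`, which stands for the inserted
        -- value `0`.
        · by_cases e : Y = X
          · subst e; simpa using hG.zero Y
          · simpa [Function.update_of_ne e] using hY Y
    · subst hs
      exact ih hn.2 (fun Y hYl => ht Y (by simp [hYl])) ⟨x, hx, hY⟩

/-- Flags are raised but never lowered during the loop, so an error-free result certifies each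
single iteration. -/
theorem modifyStep_errors {σ : ServerState K V W C I s} {j : Fin N} {m : Symbol N K (W j)}
    {requested : Fin K → Tag N} {X : Fin K} {r r' : Modif K (W j)}
    (h : modifyStep P s σ j m requested X r r') (Y : Fin K) :
    (r'.error1 Y = false → r.error1 Y = false) ∧ (r'.error2 Y = false → r.error2 Y = false) := by
  have key : ∀ (f : Fin K → Bool), Function.update f X true Y = false → f Y = false := by
    intro f hf
    by_cases hY : Y = X
    · subst hY; simp at hf
    · simpa [hY] using hf
  rcases ite_prop_iff_or.1 h with ⟨-, r₁, h₁, h₂⟩ | ⟨-, rfl⟩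
  · have a₁ : (r₁.error1 Y = false → r.error1 Y = false) ∧ r₁.error2 = r.error2 := by
      rcases ite_prop_iff_or.1 h₁ with ⟨-, w, -, rfl⟩ | ⟨-, h₁⟩
      · exact ⟨id, rfl⟩
      · rcases ite_prop_iff_or.1 h₁ with ⟨-, rfl⟩ | ⟨-, rfl⟩
        exacts [⟨key _, rfl⟩, ⟨id, rfl⟩]
    rw [← a₁.2]
    rcases ite_prop_iff_or.1 h₂ with ⟨-, w, -, rfl⟩ | ⟨-, rfl⟩
    exacts [⟨a₁.1, id⟩, ⟨a₁.1, key _⟩]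
  · exact ⟨id, id⟩

theorem modifyLoop_errors {σ : ServerState K V W C I s} {j : Fin N} {m : Symbol N K (W j)}
    {requested : Fin K → Tag N} {l : List (Fin K)} {r r' : Modif K (W j)}
    (h : Loop (modifyStep P s σ j m requested) l r r') (Y : Fin K) :
    (r'.error1 Y = false → r.error1 Y = false) ∧ (r'.error2 Y = false → r.error2 Y = false) :=
  h.rel (R := fun r r' : Modif K (W j) => (r'.error1 Y = false → r.error1 Y = false) ∧
      (r'.error2 Y = false → r.error2 Y = false))
    (fun _ => ⟨id, id⟩) (fun _ _ _ h₁ h₂ => ⟨h₁.1 ∘ h₂.1, h₁.2 ∘ h₂.2⟩)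
    (fun _ _ _ hs => modifyStep_errors hs Y)

/-- Without an error, the local list supplies the requested value, and it supplies the value to be
removed unless the tag is `0`. Uniqueness of versions identifies these list values with the entries
of `x` and `z`. -/
theorem modifyStep_codeword (hG : IsVersioning G) {σ : ServerState K V W C I s}
    (h : ServerCorrect P G σ) {j : Fin N} {m : Symbol N K (W j)} {requested : Fin K → Tag N}
    {X : Fin K} {x z : Fin K → V} (hx : G X (m.tagvec X) (x X)) (hz : G X (requested X) (z X))
    {r r' : Modif K (W j)} (hs : modifyStep P s σ j m requested X r r')
    (hr : r.codeword = P.Φ j x) (he₁ : r'.error1 X = false) (he₂ : r'.error2 X = false) :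
    r'.codeword = P.Φ j (Function.update x X (z X)) := by
  rcases ite_prop_iff_or.1 hs with ⟨hc, r₁, h₁, h₂⟩ | ⟨hc, hs⟩
  · rcases ite_prop_iff_or.1 h₂ with ⟨hd, v, hv, rfl⟩ | ⟨hd, h₂⟩
    · simp only at he₁
      obtain rfl : v = z X := hG.unique (h.list hv).1 hz
      have hr₁ : r₁.codeword = P.Φ j (Function.update x X 0) := by
        rcases ite_prop_iff_or.1 h₁ with ⟨-, w, hw, rfl⟩ | ⟨e₁, h₁⟩
        · obtain rfl : w = x X := hG.unique (h.list hw).1 hx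
          simp only [hr, P.reencode]
        rcases ite_prop_iff_or.1 h₁ with ⟨e₂, rfl⟩ | ⟨e₂, rfl⟩
        · simp at he₁
        -- Tag `0` stands for the value `0`, so there is nothing to remove.
        · rw [not_not] at e₂
          have : x X = 0 := hG.unique (e₂ ▸ hx) (hG.zero X)
          rw [hr, ← this, Function.update_eq_self]
      have := P.reencode j X (Function.update x X 0) (z X)
      simp only [Function.update_self, Function.update_idem] at this
      simp only [hr₁, this]
    · subst h₂; simp at he₂
  -- A skipped object either does not influence the symbol or already has the requested tag, and
  -- hence the requested value.
  · subst hs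
    rw [hr]
    by_cases hst : StoresObject P.Φ j X
    · have e : requested X = m.tagvec X := by tauto
      rw [hG.unique hz (e ▸ hx), Function.update_eq_self]
    · rw [encode_update_of_not_stores hst]

/-- The encoded vector interpolates between two data vectors: it has the versions of the received
symbol at the objects still in the list, and those of `z` at all others. -/
theorem modifyLoop_codeword (hG : IsVersioning G) {σ : ServerState K V W C I s}
    (h : ServerCorrect P G σ) {j : Fin N} {m : Symbol N K (W j)} {requested : Fin K → Tag N}
    {z : Fin K → V} (hz : ∀ Y, G Y (requested Y) (z Y)) {l : List (Fin K)}
    {r r' : Modif K (W j)} (hl : Loop (modifyStep P s σ j m requested) l r r')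
    (he : ∀ Y, r'.error1 Y = false ∧ r'.error2 Y = false) {x : Fin K → V} (hn : l.Nodup)
    (hr : r.codeword = P.Φ j x) (hx : ∀ Y ∈ l, G Y (m.tagvec Y) (x Y))
    (hx' : ∀ Y ∉ l, x Y = z Y) : r'.codeword = P.Φ j z := by
  induction hl generalizing x with
  | nil a =>
    rw [hr]; congr 1; funext Y; exact hx' Y (by simp)
  | @cons X l a b c hs hl ih =>
    rw [List.nodup_cons] at hn
    have hb := modifyLoop_errors hl X
    have := modifyStep_codeword hG h (hx X (by simp)) (hz X) hs hr (hb.1 (he X).1) (hb.2 (he X).2)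
    refine ih he hn.2 this (fun Y hY => ?_) (fun Y hY => ?_)
    · have e : Y ≠ X := fun e => hn.1 (e ▸ hY)
      rw [Function.update_of_ne e]
      exact hx Y (by simp [hY])
    · by_cases e : Y = X
      · subst e; simp
      · rw [Function.update_of_ne e]
        exact hx' Y (by simp [hY, e])

end Local

/-! ### Transitions of one server: preservation of the local invariant, and what clients see. -/

section Transitions

variable {N K : ℕ} {F : Type uF} {V : Type uV} {W : Fin N → Type uW} {C : Type uC} {I : Type uI}
  [Field F] [AddCommGroup V] [Module F V] [∀ i, AddCommGroup (W i)] [∀ i, Module F (W i)]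

/-! ### The effect of a transition of a server -/

/-- The effect of a transition of server `s` on its own state and on the messages to the other
servers. -/
structure ServerEffect (P : Params N K F V W C) (G : Fin K → Tag N → V → Prop) {s : Fin N}
    (a b : Loc K V W C I s) : Prop where
  correct : ServerCorrect P G b.st
  out : ∀ j m, m ∈ b.out j → m ∈ a.out j ∨ MsgCorrect P G m
  vc_le : a.st.vc ≤ b.st.vc
  vc_source : ∀ p, b.st.vc p ≤ a.st.vc p ∨ ∃ X t v, G X t v ∧ b.st.vc p ≤ t.ts p
  used : a.used ⊆ b.used

/-- Client `c` has at most one entry in the list `R` of pending reads. -/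
def AtMostOneRead (R : Set (ReadEntry K W C I)) (c : C) : Prop :=
  ∀ e ∈ R, ∀ f ∈ R, e.client = some c → f.client = some c → e = f

/-- The effect of a transition on a client `c` none of whose requests is being received: either
nothing visible happens, or a pending read is answered with a correct version. -/
def ClientEffect (G : Fin K → Tag N → V → Prop) {s : Fin N} (a b : Loc K V W C I s) (c : C) :
    Prop :=
  (b.resps c = a.resps c ∧ AtMostOneRead b.st.readL c ∧
    ∀ e' ∈ b.st.readL, e'.client = some c →
      ∃ e ∈ a.st.readL, e.client = some c ∧ e.opid = e'.opid ∧ e.obj = e'.obj) ∨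
  ∃ e ∈ a.st.readL, e.client = some c ∧ ∃ v, (∃ t, G e.obj t v ∧ t.ts ≤ b.st.vc) ∧
    b.resps c = a.resps c ∪ {.readReturn e.opid v} ∧ ∀ e' ∈ b.st.readL, e'.client ≠ some c

variable {P : Params N K F V W C} {G : Fin K → Tag N → V → Prop} {s : Fin N}

theorem Loc.mem_out_send {a : Loc K V W C I s} {Q : Fin N → Prop} {m m' : Msg K V W C I s}
    {j : Fin N} (h : m' ∈ (a.send Q m).out j) : m' ∈ a.out j ∨ m' = m := by
  unfold Loc.send at h
  dsimp only at h
  split_ifs at h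
  · simpa using h
  · exact Or.inl h

theorem ClientEffect.of_eq {a b : Loc K V W C I s} {c : C} (hu : AtMostOneRead a.st.readL c)
    (h₁ : b.resps c = a.resps c)
    (h₂ : ∀ e ∈ b.st.readL, e.client = some c → e ∈ a.st.readL) : ClientEffect G a b c :=
  Or.inl ⟨h₁, fun e he e' he' hc hc' => hu e (h₂ e he hc) e' (h₂ e' he' hc') hc hc',
    fun e he hc => ⟨e, h₂ e he hc, hc, rfl, rfl⟩⟩

/-- Although a whole set of entries is answered, a client owns at most one entry, so it receives at
most one response. -/
theorem ClientEffect.clearReads {a a₁ : Loc K V W C I s} {D : Set (ReadEntry K W C I)} {v : V}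
    {c : C} (hu : AtMostOneRead a.st.readL c) (h₁ : a₁.resps c = a.resps c)
    (h₂ : a₁.st.readL = a.st.readL)
    (hD : ∀ e ∈ D, ∃ t, G e.obj t v ∧ t.ts ≤ a₁.st.vc) :
    ClientEffect G a (a₁.clearReads D v) c := by
  by_cases h : ∃ e ∈ a.st.readL ∩ D, e.client = some c
  · obtain ⟨e, he, hc⟩ := h
    refine Or.inr ⟨e, he.1, hc, v, hD e he.2, ?_, ?_⟩
    · ext r
      simp only [Loc.clearReads, h₁, h₂, Set.mem_union, Set.mem_ofPred_eq, Set.mem_singleton_iff]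
      refine or_congr_right ⟨?_, fun hr => ⟨e, he, hc, hr⟩⟩
      rintro ⟨e', he', hc', rfl⟩
      rw [hu e he.1 e' he'.1 hc hc']
    · rintro e' ⟨he', hD'⟩ hc'
      rw [h₂] at he'
      exact hD' (hu e he.1 e' he' hc hc' ▸ he.2)
  · refine ClientEffect.of_eq hu ?_ ?_
    · ext r
      simp only [Loc.clearReads, h₁, h₂, Set.mem_union, Set.mem_ofPred_eq]
      refine ⟨?_, Or.inl⟩
      rintro (hr | ⟨e, he, hc, -⟩)
      exacts [hr, absurd ⟨e, he, hc⟩ h]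
    · rintro e ⟨he, -⟩ -
      rwa [h₂] at he

theorem ServerEffect.clearReads {a a₁ : Loc K V W C I s} {D : Set (ReadEntry K W C I)} {v : V}
    (h : ServerEffect P G a a₁) : ServerEffect P G a (a₁.clearReads D v) where
  correct := h.correct.subset Set.sdiff_subset
  out := h.out
  vc_le := h.vc_le
  vc_source := h.vc_source
  used := h.used

theorem ServerEffect.send {a a₁ : Loc K V W C I s} {Q : Fin N → Prop} {m : Msg K V W C I s}
    (h : ServerEffect P G a a₁) (hm : MsgCorrect P G m) : ServerEffect P G a (a₁.send Q m) where
  correct := h.correct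
  out j m' hm' := by
    rcases Loc.mem_out_send hm' with hm' | rfl
    exacts [h.out j m' hm', Or.inr hm]
  vc_le := h.vc_le
  vc_source := h.vc_source
  used := h.used

theorem ServerEffect.reply {a a₁ : Loc K V W C I s} {c : C} {r : Resp V I}
    (h : ServerEffect P G a a₁) : ServerEffect P G a (a₁.reply c r) :=
  ⟨h.correct, h.out, h.vc_le, h.vc_source, h.used⟩

/-- A transition that changes neither the clock nor the outgoing messages. -/
theorem ServerEffect.of_correct {a b : Loc K V W C I s} (h : ServerCorrect P G b.st)
    (ho : b.out = a.out) (hv : b.st.vc = a.st.vc) (hu : b.used = a.used) :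
    ServerEffect P G a b where
  correct := h
  out _ _ hm := Or.inl (ho ▸ hm)
  vc_le := hv.ge
  vc_source p := Or.inl (congrFun hv p).le
  used := hu.ge

/-! ### Requests -/

theorem onWrite_serverEffect {c : C} {o : I} {X : Fin K} {v : V} {a b : Loc K V W C I s}
    (h : ServerCorrect P G a.st) (hb : onWrite P s c o X v a b)
    (hG : G X ⟨b.st.vc, P.cid c⟩ v) : ServerEffect P G a b := by
  unfold onWrite at hb
  subst hb
  have hle : a.st.vc ≤ Function.update a.st.vc s (a.st.vc s + 1) :=
    le_update_self_iff.2 (Nat.le_succ _)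
  refine ServerEffect.clearReads (ServerEffect.send (ServerEffect.reply ?_) hG)
  refine ⟨ServerCorrect.addToL (h.advance hle subset_rfl) hG le_rfl ?_,
    fun j m hm => Or.inl hm, hle, fun p => Or.inr ⟨X, _, v, hG, le_rfl⟩, subset_rfl⟩
  -- No internal read can ask for the new tag: it exceeds the old clock in component `s`, while the
  -- tags of the local symbol do not.
  rintro e he - rfl ht
  have h₁ : (a.st.M.tagvec e.obj).ts s ≤ a.st.vc s := h.symbol_le e.obj s
  have h₂ : (a.st.M.tagvec e.obj).ts s = a.st.vc s + 1 := by
    simpa using congrArg (fun t : Tag N => t.ts s) ht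
  omega

theorem onWrite_vc {c : C} {o : I} {X : Fin K} {v : V} {a b : Loc K V W C I s}
    (hb : onWrite P s c o X v a b) :
    b.st.vc = Function.update a.st.vc s (a.st.vc s + 1) := by
  unfold onWrite at hb
  subst hb
  rfl

theorem onWrite_clientEffect {c c' : C} {o : I} {X : Fin K} {v : V} {a b : Loc K V W C I s}
    (hu : AtMostOneRead a.st.readL c') (hb : onWrite P s c o X v a b)
    (hG : G X ⟨b.st.vc, P.cid c⟩ v) (hc : c' ≠ c) : ClientEffect G a b c' := by
  unfold onWrite at hb
  subst hb
  refine ClientEffect.clearReads hu ?_ rfl ?_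
  · simp [Loc.send, Loc.reply, Function.update_of_ne hc]
  · rintro e ⟨-, rfl⟩
    exact ⟨_, hG, le_rfl⟩

theorem onWrite_client {c : C} {o : I} {X : Fin K} {v : V} {a b : Loc K V W C I s}
    (hn : ∀ e ∈ a.st.readL, e.client ≠ some c) (hb : onWrite P s c o X v a b) :
    b.resps c = a.resps c ∪ {.writeAck o} ∧ ∀ e ∈ b.st.readL, e.client ≠ some c := by
  unfold onWrite at hb
  subst hb
  refine ⟨?_, fun e he => hn e he.1⟩
  ext r
  simp only [Loc.clearReads, Loc.send, Loc.reply, ServerState.addToL, Function.update_self,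
    Set.mem_union, Set.mem_ofPred_eq]
  refine ⟨?_, Or.inl⟩
  rintro (hr | ⟨e, he, hc, -⟩)
  exacts [hr, absurd hc (hn e he.1)]

/-- The three possible outcomes of a read request. -/
theorem onRead_cases {c : C} {o : I} {X : Fin K} {a b : Loc K V W C I s}
    (h : ServerCorrect P G a.st) (hb : onRead P s c o X a b) :
    (∃ v, (∃ t, G X t v ∧ t.ts ≤ a.st.vc) ∧ b = a.reply c (.readReturn o v)) ∨
    b = Loc.send
        { a with st := { a.st with
            readL := a.st.readL ∪ {⟨some c, o, X, a.st.M.tagvec, onlyAt s a.st.M.val⟩} } }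
        (fun _ => True) (.valInq (some c) o X a.st.M.tagvec) := by
  obtain ⟨q, hq, hb⟩ := hb
  rcases ite_prop_iff_or.1 hb with ⟨-, p, rfl, rfl⟩ | ⟨-, hb⟩
  -- Membership in the list is all that is needed; that the entry is highest plays no role for
  -- correctness.
  · exact Or.inl ⟨p.2, ⟨p.1, h.list hq.1⟩, rfl⟩
  rcases ite_prop_iff_or.1 hb with ⟨-, v, hv, rfl⟩ | ⟨-, rfl⟩
  · obtain ⟨x, hx, hY⟩ := h.symbol
    have := hv.eq (x := x) fun i w hw => eq_of_onlyAt (f := fun i => P.Φ i x) hw hx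
    exact Or.inl ⟨v, ⟨_, this ▸ hY X, h.symbol_le X⟩, rfl⟩
  · exact Or.inr rfl

theorem onRead_serverEffect {c : C} {o : I} {X : Fin K} {a b : Loc K V W C I s}
    (h : ServerCorrect P G a.st) (hb : onRead P s c o X a b) : ServerEffect P G a b := by
  rcases onRead_cases h hb with ⟨v, -, rfl⟩ | rfl
  · exact ServerEffect.reply (ServerEffect.of_correct h rfl rfl rfl)
  · exact ServerEffect.send (ServerEffect.of_correct (h.addRead _ _ _ (by simp)) rfl rfl rfl)
      trivial

theorem onRead_clientEffect {c c' : C} {o : I} {X : Fin K} {a b : Loc K V W C I s}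
    (h : ServerCorrect P G a.st) (hu : AtMostOneRead a.st.readL c') (hb : onRead P s c o X a b)
    (hc : c' ≠ c) : ClientEffect G a b c' := by
  rcases onRead_cases h hb with ⟨v, -, rfl⟩ | rfl
  · exact ClientEffect.of_eq hu (by simp [Loc.reply, Function.update_of_ne hc])
      fun e he _ => he
  · refine ClientEffect.of_eq hu rfl fun e he hec => ?_
    rcases he with he | rfl
    · exact he
    · exact absurd (Option.some.inj hec) hc.symm

/-! ### Messages -/

theorem onValInq_serverEffect (hG : IsVersioning G) {j : Fin N} {cl : Option C} {o : I}
    {X : Fin K} {wanted : Fin K → Tag N} {a b : Loc K V W C I s} (h : ServerCorrect P G a.st)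
    (hb : onValInq P s j cl o X wanted a b) : ServerEffect P G a b := by
  rcases ite_prop_iff_or.1 hb with ⟨-, v, hv, rfl⟩ | ⟨-, r, ⟨l, hn, -, hl⟩, rfl⟩
  · exact ServerEffect.send (ServerEffect.of_correct h rfl rfl rfl) (h.list hv).1
  · exact ServerEffect.send (ServerEffect.of_correct h rfl rfl rfl)
      (encodes_of_responseLoop hG h hl hn (fun _ _ => rfl) h.symbol)

theorem onValInq_clientEffect {j : Fin N} {cl : Option C} {o : I}
    {X : Fin K} {wanted : Fin K → Tag N} {a b : Loc K V W C I s} {c : C}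
    (hu : AtMostOneRead a.st.readL c)
    (hb : onValInq P s j cl o X wanted a b) : ClientEffect G a b c := by
  rcases ite_prop_iff_or.1 hb with ⟨-, v, hv, rfl⟩ | ⟨-, r, -, rfl⟩
  all_goals exact ClientEffect.of_eq hu rfl fun e he _ => he

theorem onValResp_effect {cl : Option C} {o : I} {X : Fin K} {v : V}
    {requested : Fin K → Tag N} {a b : Loc K V W C I s} (h : ServerCorrect P G a.st)
    (hv : G X (requested X) v) (hu : ∀ c, AtMostOneRead a.st.readL c)
    (hb : onValResp s X v cl o requested a b) :
    ServerEffect P G a b ∧ ∀ c, ClientEffect G a b c := by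
  rcases ite_prop_iff_or.1 hb with ⟨-, w, hw, hb⟩ | ⟨-, rfl⟩
  swap
  · exact ⟨ServerEffect.of_correct h rfl rfl rfl,
      fun c => ClientEffect.of_eq (hu c) rfl fun e he _ => he⟩
  -- The message carries no bound on the timestamp of its version; the bound comes from the entry
  -- that is still pending.
  have hle := (h.reads _ hw).1
  cases cl with
  | none =>
    dsimp only at hb
    subst hb
    refine ⟨ServerEffect.of_correct ?_ rfl rfl rfl,
      fun c => ClientEffect.of_eq (hu c) rfl fun e he _ => he.1⟩
    refine (h.subset Set.sdiff_subset).addToL hv hle ?_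
    -- The version that arrives may be the one an internal read waits for, but the only internal
    -- read of this object has just been removed.
    rintro e ⟨he, hne⟩ hc hX
    exact absurd (h.localhost_unique e he _ hw hc rfl hX) hne
  | some c₀ =>
    dsimp only at hb
    subst hb
    refine ⟨ServerEffect.reply (ServerEffect.of_correct (h.subset Set.sdiff_subset) rfl rfl rfl),
      fun c => ?_⟩
    by_cases hc : c = c₀
    · subst hc
      refine Or.inr ⟨_, hw, rfl, v, ⟨_, hv, hle⟩, by simp [Loc.reply], ?_⟩
      rintro e ⟨he, hne⟩ hec
      exact hne (hu c e he _ hw hec rfl)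
    · exact ClientEffect.of_eq (hu c) (by simp [Loc.reply, Function.update_of_ne hc])
        fun e he _ => he.1

/-- The received symbol is recoded to the vector `z` requested by the pending read, which the
symbols collected earlier encode as well. A decoded value is therefore the entry of `z`, that is,
the requested version. -/
theorem onValRespEncoded_effect (hG : IsVersioning G) {j : Fin N} {m : Symbol N K (W j)}
    {cl : Option C} {o : I} {X : Fin K}
    {requested : Fin K → Tag N} {a b : Loc K V W C I s} (h : ServerCorrect P G a.st)
    (hm : Encodes P G m) (hu : ∀ c, AtMostOneRead a.st.readL c)
    (hb : onValRespEncoded P s j m cl o X requested a b) :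
    ServerEffect P G a b ∧ ∀ c, ClientEffect G a b c := by
  rcases ite_prop_iff_or.1 hb with ⟨-, w, hw, r, ⟨l, hn, hall, hl⟩, hb⟩ | ⟨-, rfl⟩
  swap
  · exact ⟨ServerEffect.of_correct (h.congr rfl rfl rfl rfl rfl) rfl rfl rfl,
      fun c => ClientEffect.of_eq (hu c) rfl fun e he _ => he⟩
  dsimp only at hb
  rcases ite_prop_iff_or.1 hb with ⟨herr, hb⟩ | ⟨-, rfl⟩
  swap
  · exact ⟨ServerEffect.of_correct (h.congr rfl rfl rfl rfl rfl) rfl rfl rfl,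
      fun c => ClientEffect.of_eq (hu c) rfl fun e he _ => he⟩
  obtain ⟨hle, z, hz, hsym⟩ := h.reads _ hw
  dsimp only at hle hz hsym
  obtain ⟨x, hx, hY⟩ := hm
  have hr : r.codeword = P.Φ j z :=
    modifyLoop_codeword hG h hz hl herr hn hx (fun Y _ => hY Y) fun Y hYl => absurd (hall Y) hYl
  have hsym' : ∀ i y, Function.update w j (some r.codeword) i = some y → y = P.Φ i z := by
    intro i y hy
    by_cases hi : i = j
    · subst hi
      rw [Function.update_self, Option.some.injEq] at hy
      rw [← hy, hr]
    · rw [Function.update_of_ne hi] at hy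
      exact hsym i y hy
  rcases ite_prop_iff_or.1 hb with ⟨-, T, v, hv, hb⟩ | ⟨-, rfl⟩
  · have hvz : v = z X := hv.eq hsym'
    have hGv : G X (requested X) v := hvz ▸ hz X
    cases cl with
    | none =>
      dsimp only at hb
      subst hb
      refine ⟨ServerEffect.of_correct ?_ rfl rfl rfl,
        fun c => ClientEffect.of_eq (hu c) rfl fun e he _ => he.1⟩
      -- The value is stored under the current tag of the local symbol. The invariant on internal
      -- reads makes it equal to the requested tag.
      obtain ⟨-, htag, -⟩ := h.localhost _ hw rfl
      dsimp only at htag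
      refine ServerCorrect.addToL ?_ (htag ▸ hGv) (h.symbol_le X) ?_
      · exact (h.subset (R := {e ∈ a.st.readL | ¬ (e.client = none ∧ e.opid = o ∧ e.obj = X ∧
          e.tagvec = requested)}) (fun e he => he.1)).congr rfl rfl rfl rfl rfl
      rintro e ⟨he, hne⟩ hc hX
      obtain rfl := h.localhost_unique e he _ hw hc rfl hX
      exact absurd ⟨rfl, rfl, rfl, rfl⟩ hne
    | some c₀ =>
      dsimp only at hb
      subst hb
      refine ⟨ServerEffect.reply (ServerEffect.of_correct
        ((h.subset (R := {e ∈ a.st.readL | ¬ (e.client = some c₀ ∧ e.opid = o ∧ e.obj = X ∧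
          e.tagvec = requested)}) (fun e he => he.1)).congr rfl rfl rfl rfl rfl) rfl rfl rfl),
        fun c => ?_⟩
      by_cases hc : c = c₀
      · subst hc
        refine Or.inr ⟨_, hw, rfl, v, ⟨_, hGv, hle⟩, by simp [Loc.reply], ?_⟩
        rintro e ⟨he, hne⟩ hec
        obtain rfl := hu c e he _ hw hec rfl
        exact hne ⟨rfl, rfl, rfl, rfl⟩
      · exact ClientEffect.of_eq (hu c) (by simp [Loc.reply, Function.update_of_ne hc])
          fun e he _ => he.1
  -- The updated entry differs from the one it replaces only in the symbols, so everything else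
  -- transfers, including uniqueness.
  · have old : ∀ e' ∈ (a.st.readL \ {⟨cl, o, X, requested, w⟩}) ∪
        {(⟨cl, o, X, requested, Function.update w j (some r.codeword)⟩ : ReadEntry K W C I)},
        ∃ e ∈ a.st.readL, e.client = e'.client ∧ e.opid = e'.opid ∧ e.obj = e'.obj ∧
          e.tagvec = e'.tagvec := by
      rintro e' (he' | rfl)
      exacts [⟨e', he'.1, rfl, rfl, rfl, rfl⟩, ⟨_, hw, rfl, rfl, rfl, rfl⟩]
    refine ⟨ServerEffect.of_correct ?_ rfl rfl rfl, fun c => Or.inl ⟨rfl, ?_, ?_⟩⟩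
    · refine ⟨h.inQueue, h.list, h.symbol, h.symbol_le, ?_, ?_, ?_⟩
      · rintro e (he | rfl)
        exacts [h.reads e he.1, ⟨hle, z, hz, hsym'⟩]
      · intro e' he' hc
        obtain ⟨e, he, h₁, -, h₃, h₄⟩ := old e' he'
        have := h.localhost e he (h₁.trans hc)
        rwa [h₃, h₄] at this
      · rintro e (he | rfl) e' (he' | rfl) hc hc' ho
        · exact h.localhost_unique e he.1 e' he'.1 hc hc' ho
        · exact absurd (h.localhost_unique e he.1 _ hw hc hc' ho) he.2
        · exact absurd (h.localhost_unique e' he'.1 _ hw hc' hc ho.symm) he'.2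
        · rfl
    · rintro e (he | rfl) e' (he' | rfl) hc hc'
      · exact hu c e he.1 e' he'.1 hc hc'
      · exact absurd (hu c e he.1 _ hw hc hc') he.2
      · exact absurd (hu c e' he'.1 _ hw hc' hc) he'.2
      · rfl
    · intro e' he' hc
      obtain ⟨e, he, h₁, h₂, h₃, -⟩ := old e' he'
      exact ⟨e, he, h₁.trans hc, h₂, h₃⟩

theorem onMsg_effect (hG : IsVersioning G) {j : Fin N} {m : Msg K V W C I j}
    {a b : Loc K V W C I s} (h : ServerCorrect P G a.st) (hm : MsgCorrect P G m)
    (hu : ∀ c, AtMostOneRead a.st.readL c) (hb : onMsg P s j m a b) :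
    ServerEffect P G a b ∧ ∀ c, ClientEffect G a b c := by
  cases m with
  | app X v t =>
    simp only [onMsg] at hb
    subst hb
    refine ⟨ServerEffect.of_correct ?_ rfl rfl rfl,
      fun c => ClientEffect.of_eq (hu c) rfl fun e he _ => he⟩
    refine ⟨?_, h.list, h.symbol, h.symbol_le, h.reads, h.localhost, h.localhost_unique⟩
    rintro j' X' v' t' (hq | hq)
    · exact h.inQueue hq
    · obtain ⟨rfl, rfl, rfl, rfl⟩ := hq
      exact hm
  | del X t =>
    simp only [onMsg] at hb
    subst hb
    exact ⟨ServerEffect.of_correct (h.congr rfl rfl rfl rfl rfl) rfl rfl rfl,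
      fun c => ClientEffect.of_eq (hu c) rfl fun e he _ => he⟩
  | valInq cl o X wanted =>
    exact ⟨onValInq_serverEffect hG h hb, fun c => onValInq_clientEffect (hu c) hb⟩
  | valResp X v cl o requested => exact onValResp_effect h hm hu hb
  | valRespEncoded m cl o X requested => exact onValRespEncoded_effect hG h hm hu hb

/-! ### Internal actions -/

/-- The delivery condition does two things: it puts the applied timestamp below the new clock, and
it puts its component `j` just above the old one, so that the version is new to this server. -/
theorem applyInQueue_effect {a b : Loc K V W C I s} (h : ServerCorrect P G a.st)
    (hu : ∀ c, AtMostOneRead a.st.readL c) (hb : applyInQueue s a b) :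
    ServerEffect P G a b ∧ ∀ c, ClientEffect G a b c := by
  obtain ⟨j, X, v, t, hq, -, hb⟩ := hb
  rcases ite_prop_iff_or.1 hb with ⟨⟨ht, hj⟩, hb⟩ | ⟨-, rfl⟩
  swap
  · exact ⟨ServerEffect.of_correct h rfl rfl rfl,
      fun c => ClientEffect.of_eq (hu c) rfl fun e he _ => he⟩
  dsimp only at hb
  subst hb
  have hGt : G X t v := h.inQueue hq
  have hle : a.st.vc ≤ Function.update a.st.vc j (t.ts j) := le_update_self_iff.2 (by omega)
  have htle : t.ts ≤ Function.update a.st.vc j (t.ts j) :=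
    le_update_iff.2 ⟨le_rfl, fun p hp => ht p hp⟩
  constructor
  · refine ServerEffect.clearReads ⟨?_, fun j m hm => Or.inl hm, hle, fun p => ?_, subset_rfl⟩
    · refine ServerCorrect.addToL (h.advance hle Set.sdiff_subset) hGt htle ?_
      -- The tags of the local symbol are below the old clock in component `j`, so none of them
      -- equals the applied tag.
      rintro e - - rfl htag
      have : (a.st.M.tagvec e.obj).ts j ≤ a.st.vc j := h.symbol_le e.obj j
      dsimp only at htag
      rw [htag] at this
      omega
    · by_cases hp : p = j
      · subst hp
        exact Or.inr ⟨X, t, v, hGt, by simp [ServerState.addToL]⟩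
      · exact Or.inl (by simp [ServerState.addToL, Function.update_of_ne hp])
  · intro c
    refine ClientEffect.clearReads (hu c) rfl rfl ?_
    rintro e ⟨rfl, -⟩
    exact ⟨t, hGt, htle⟩

/-- Transitions that are invisible to the clients and keep the clock. -/
structure Quiet (P : Params N K F V W C) (G : Fin K → Tag N → V → Prop) {s : Fin N}
    (a b : Loc K V W C I s) : Prop where
  correct : ServerCorrect P G a.st → ServerCorrect P G b.st
  out : ∀ j m, m ∈ b.out j → m ∈ a.out j ∨ MsgCorrect P G m
  vc : b.st.vc = a.st.vc
  used : a.used ⊆ b.used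
  resps : b.resps = a.resps
  reads : ∀ e ∈ b.st.readL, e.client ≠ none → e ∈ a.st.readL

theorem Quiet.refl (a : Loc K V W C I s) : Quiet P G a a :=
  ⟨id, fun _ _ => Or.inl, rfl, subset_rfl, rfl, fun _ he _ => he⟩

theorem Quiet.trans {a b c : Loc K V W C I s} (h₁ : Quiet P G a b) (h₂ : Quiet P G b c) :
    Quiet P G a c :=
  ⟨h₂.correct ∘ h₁.correct, fun j m hm => (h₂.out j m hm).elim (h₁.out j m) Or.inr,
    h₂.vc.trans h₁.vc, h₁.used.trans h₂.used, h₂.resps.trans h₁.resps,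
    fun e he hc => h₁.reads e (h₂.reads e he hc) hc⟩

theorem Quiet.send {a b : Loc K V W C I s} (h : Quiet P G a b) {Q : Fin N → Prop}
    {m : Msg K V W C I s} (hm : MsgCorrect P G m) : Quiet P G a (b.send Q m) :=
  ⟨h.correct, fun j m' hm' => (Loc.mem_out_send hm').elim (h.out j m')
    (fun e => Or.inr (e ▸ hm)), h.vc, h.used, h.resps, h.reads⟩

theorem Quiet.effect {a b : Loc K V W C I s} (h : Quiet P G a b) (ha : ServerCorrect P G a.st)
    (hu : ∀ c, AtMostOneRead a.st.readL c) :
    ServerEffect P G a b ∧ ∀ c, ClientEffect G a b c :=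
  ⟨⟨h.correct ha, h.out, h.vc.ge, fun p => Or.inl (congrFun h.vc p).le, h.used⟩,
    fun c => ClientEffect.of_eq (hu c) (congrFun h.resps c)
      fun e he hc => h.reads e he (by simp [hc])⟩

/-- Replacing the version of `X` in the local symbol. -/
theorem ServerCorrect.setSymbol {σ : ServerState K V W C I s} (h : ServerCorrect P G σ)
    {X : Fin K} {t : Tag N} {v : V} (hv : (t, v) ∈ σ.L X) {y : W s}
    (hy : ∀ x, σ.M.val = P.Φ s x → G X (σ.M.tagvec X) (x X) → y = P.Φ s (Function.update x X v))
    (hl : ∀ e ∈ σ.readL, e.client = none → e.obj ≠ X) :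
    ServerCorrect P G { σ with M := ⟨y, Function.update σ.M.tagvec X t⟩ } where
  inQueue := h.inQueue
  list := h.list
  symbol := by
    obtain ⟨x, hx, hY⟩ := h.symbol
    refine ⟨Function.update x X v, hy x hx (hY X), fun Y => ?_⟩
    by_cases e : Y = X
    · subst e; simpa using (h.list hv).1
    · simpa [Function.update_of_ne e] using hY Y
  symbol_le Y := by
    by_cases e : Y = X
    · subst e; simpa using (h.list hv).2
    · simpa [Function.update_of_ne e] using h.symbol_le Y
  reads := h.reads
  localhost e he hc := by
    have := h.localhost e he hc
    simpa only [Function.update_of_ne (hl e he hc)] using this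
  localhost_unique := h.localhost_unique

/-- The symbol is re-encoded only if the list contains the version currently encoded. A pending
internal read of `X` means that this version is missing, so the tag such a read relies on stays
fixed. -/
theorem encodeStored_quiet (hG : IsVersioning G) {X : Fin K} {a b : Loc K V W C I s}
    (hb : encodeStored P s X a b) : Quiet P G a b := by
  obtain ⟨q, -, hb⟩ := hb
  rcases ite_prop_iff_or.1 hb with ⟨⟨hst, -⟩, p, -, hb⟩ | ⟨-, rfl⟩
  swap
  · exact Quiet.refl _
  rcases ite_prop_iff_or.1 hb with ⟨-, u, v, hu, hv, rfl⟩ | ⟨hno, hb⟩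
  · refine Quiet.send ?_ trivial
    refine ⟨fun h => ?_, fun _ _ => Or.inl, rfl, subset_rfl, rfl, fun _ he _ => he⟩
    refine (h.setSymbol hv (y := P.Γ s X a.st.M.val u v) (fun x hx hxX => ?_) ?_).congr
      rfl rfl rfl rfl rfl
    -- The list entry with the old tag is the value encoded in the symbol, so re-encoding is exact.
    · rw [hx, hG.unique (h.list hu).1 hxX, P.reencode]
    · rintro e he hc rfl
      exact (h.localhost e he hc).2.2 u hu
  rcases ite_prop_iff_or.1 hb with ⟨-, rfl⟩ | ⟨hnl, o, -, rfl⟩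
  · exact Quiet.refl _
  · refine Quiet.send ?_ trivial
    refine ⟨fun h => ?_, fun _ _ => Or.inl, rfl, Set.subset_union_left, rfl, ?_⟩
    · refine h.addRead none o X fun _ => ⟨hst, fun v hv => hno ⟨v, hv⟩, ?_⟩
      -- Any internal read of `X` has the current tag of the symbol at `X`, so the guard of the
      -- algorithm excludes all of them.
      rintro e he hc rfl
      exact hnl ⟨e, he, hc, rfl, (h.localhost e he hc).2.1⟩
    · rintro e (he | rfl) hc
      exacts [he, absurd rfl hc]

/-- Relabelling the symbol without changing it is sound because it does not depend on `X`. Internal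
reads concern stored objects only and are not affected. -/
theorem encodeNotStored_quiet {X : Fin K} {a b : Loc K V W C I s}
    (hb : encodeNotStored P s X a b) : Quiet P G a b := by
  obtain ⟨q, -, hb⟩ := hb
  rcases ite_prop_iff_or.1 hb with ⟨⟨hst, -⟩, t, ht, rfl⟩ | ⟨-, rfl⟩
  swap
  · exact Quiet.refl _
  obtain ⟨v, hv⟩ := ht.1.2.1
  refine Quiet.send ?_ trivial
  refine ⟨fun h => ?_, fun _ _ => Or.inl, rfl, subset_rfl, rfl, fun _ he _ => he⟩
  refine (h.setSymbol hv (y := a.st.M.val) (fun x hx _ => ?_) ?_).congr rfl rfl rfl rfl rfl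
  · rw [hx, encode_update_of_not_stores hst]
  · rintro e he hc rfl
    exact hst (h.localhost e he hc).1

theorem encoding_quiet (hG : IsVersioning G) {a b : Loc K V W C I s} (hb : encoding P s a b) :
    Quiet P G a b := by
  obtain ⟨a₁, h₁, h₂⟩ := hb
  exact Quiet.trans
    (h₁.rel Quiet.refl (fun _ _ _ => Quiet.trans) fun _ _ _ => encodeStored_quiet hG)
    (h₂.rel Quiet.refl (fun _ _ _ => Quiet.trans) fun _ _ _ => encodeNotStored_quiet)

theorem ServerCorrect.shrinkList {σ : ServerState K V W C I s} (h : ServerCorrect P G σ)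
    {L' : Fin K → Set (Tag N × V)} (hL : ∀ Y, L' Y ⊆ σ.L Y) :
    ServerCorrect P G { σ with L := L' } where
  inQueue := h.inQueue
  list hq := h.list (hL _ hq)
  symbol := h.symbol
  symbol_le := h.symbol_le
  reads := h.reads
  localhost e he hc := by
    obtain ⟨h₁, h₂, h₃⟩ := h.localhost e he hc
    exact ⟨h₁, h₂, fun v hv => h₃ v (hL _ hv)⟩
  localhost_unique := h.localhost_unique

/-- The set of removed entries can be arbitrary here: the invariant says that list entries are
correct, never that some entry is present. -/
theorem collectStep_quiet {X : Fin K} {a b : Loc K V W C I s}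
    (hb : collectStep P s X a b) : Quiet P G a b := by
  obtain ⟨q, tm, -, hb⟩ := hb
  dsimp only at hb
  obtain ⟨-, hb⟩ := hb
  have key : ∀ D : Set (Tag N × V), Quiet P G a
      { a with st := { a.st with
          tmax := Function.update a.st.tmax X tm
          L := Function.update a.st.L X (a.st.L X \ D) } } := fun D => by
    refine ⟨fun h => ?_, fun _ _ => Or.inl, rfl, subset_rfl, rfl, fun _ he _ => he⟩
    refine (h.shrinkList (L' := Function.update a.st.L X (a.st.L X \ D)) fun Y => ?_).congr
      rfl rfl rfl rfl rfl
    by_cases e : Y = X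
    · subst e; simp
    · simp [Function.update_of_ne e]
  rcases ite_prop_iff_or.1 hb with ⟨-, u, -, rfl⟩ | ⟨-, rfl⟩
  exacts [Quiet.send (key _) trivial, key _]

theorem garbageCollection_quiet {a b : Loc K V W C I s} (hb : garbageCollection P s a b) :
    Quiet P G a b :=
  ForEach.rel Quiet.refl (fun _ _ _ => Quiet.trans) (fun _ _ _ => collectStep_quiet) hb

end Transitions

/-! ### The invariant of the composed system: clocks, freshness of tags, and the life cycle of an
operation. -/

section Global

variable {N K : ℕ} {F : Type uF} {V : Type uV} {W : Fin N → Type uW} {C : Type uC} {I : Type uI}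
  [Field F] [AddCommGroup V] [Module F V] [∀ i, AddCommGroup (W i)] [∀ i, Module F (W i)]

/-! ### The invariant of the composed system -/

/-- The pending operation of a client is in at most one of the following places: among the
requests, among the pending reads of its server, among the responses. -/
structure ClientCorrect (P : Params N K F V W C) (γ : Config K V W C I) (c : C) : Prop where
  reqs : ∀ q ∈ γ.reqs c, γ.pending c = some q
  resps : ∀ r ∈ γ.resps c, ∃ o op, γ.pending c = some (o, op) ∧ r.Answers o op
  reads : ∀ s, ∀ e ∈ (γ.srv s).readL, e.client = some c →
    s = P.home c ∧ γ.pending c = some (e.opid, .read e.obj)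
  resps_unique : (γ.resps c).Subsingleton
  reads_unique : ∀ s, AtMostOneRead (γ.srv s).readL c
  resps_of_reqs : (γ.reqs c).Nonempty → γ.resps c = ∅
  reads_of_reqs : (γ.reqs c).Nonempty → ∀ s, ∀ e ∈ (γ.srv s).readL, e.client ≠ some c
  resps_of_reads : ∀ s, ∀ e ∈ (γ.srv s).readL, e.client = some c → γ.resps c = ∅
  used : ∀ q, γ.pending c = some q → q.1 ∈ γ.used

/-- The state of the system agrees with the versions `G`. -/
structure Correct (P : Params N K F V W C) (G : Fin K → Tag N → V → Prop)
    (γ : Config K V W C I) : Prop where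
  versioning : IsVersioning G
  server : ∀ s, ServerCorrect P G (γ.srv s)
  chan : ∀ i j, ∀ m ∈ γ.chan i j, MsgCorrect P G m
  clock : ∀ i p, (γ.srv i).vc p ≤ (γ.srv p).vc p
  version_le : ∀ X t v, G X t v → ∀ p, t.ts p ≤ (γ.srv p).vc p
  client : ∀ c, ClientCorrect P γ c

/-- What is required of a response to an operation at the time when it is sent: a read returns a
version known to the server, and a write increases the clock, from `T` to `U`. -/
def RespCorrect (G : Fin K → Tag N → V → Prop) (T U : Fin N → ℕ) : Op K V → Resp V I → Prop
  | .read X, r => ∃ o v t, r = .readReturn o v ∧ G X t v ∧ t.ts ≤ U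
  | .write _ _, _ => T < U

/-- The effect of a transition of the system on clocks, operations and responses. -/
structure StepEffect (P : Params N K F V W C) (G : Fin K → Tag N → V → Prop)
    (γ : Config K V W C I) (α : Action N K V C I) (γ' : Config K V W C I) : Prop where
  vc_le : ∀ s, (γ.srv s).vc ≤ (γ'.srv s).vc
  used : γ.used ⊆ γ'.used
  resp_keep : ∀ c, ∀ r ∈ γ.resps c, r ∈ γ'.resps c ∨ γ'.pending c = none
  pending_keep : ∀ c o op, γ.pending c = some (o, op) → γ'.pending c = some (o, op) ∨
    ∃ r ∈ γ.resps c, r.Answers o op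
  pending_new : ∀ c o op, γ'.pending c = some (o, op) → γ.pending c = some (o, op) ∨
    (α = .invoke c o op ∧ o ∉ γ.used)
  resp_new : ∀ c, ∀ r ∈ γ'.resps c, r ∉ γ.resps c → ∀ o op, γ'.pending c = some (o, op) →
    RespCorrect G (γ.srv (P.home c)).vc (γ'.srv (P.home c)).vc op r

/-- The effect of a request of client `c` that is received at server `s`. -/
def RequestEffect (P : Params N K F V W C) (G : Fin K → Tag N → V → Prop) {s : Fin N}
    (γ : Config K V W C I) (b : Loc K V W C I s) (c : C) : Prop :=
  P.home c = s ∧ γ.reqs c = ∅ ∧ γ.resps c = ∅ ∧ (∀ p, ∀ e ∈ (γ.srv p).readL, e.client ≠ some c) ∧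
  ∃ o op, γ.pending c = some (o, op) ∧
    ((∃ r, b.resps c = {r} ∧ r.Answers o op ∧ RespCorrect G (γ.srv s).vc b.st.vc op r ∧
        ∀ e ∈ b.st.readL, e.client ≠ some c) ∨
      (b.resps c = ∅ ∧ ∃ X, op = .read X ∧ AtMostOneRead b.st.readL c ∧
        ∀ e ∈ b.st.readL, e.client = some c → e.opid = o ∧ e.obj = X))

variable {P : Params N K F V W C} {G : Fin K → Tag N → V → Prop}

theorem Config.put_srv_self (γ : Config K V W C I) {s : Fin N} (b : Loc K V W C I s) :
    (γ.put s b).srv s = b.st := by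
  simp [Config.put]

theorem Config.put_srv_of_ne (γ : Config K V W C I) {s p : Fin N} (b : Loc K V W C I s)
    (h : p ≠ s) : (γ.put s b).srv p = γ.srv p := by
  simp [Config.put, Function.update_of_ne h]

/-- When a pending read is answered, its entry disappears in the transition in which the response
appears, so the operation just moves from one place to another. -/
theorem ClientCorrect.put_of_clientEffect {γ : Config K V W C I} {c : C}
    (h : ClientCorrect P γ c) {s : Fin N} {b : Loc K V W C I s} (hu : γ.used ⊆ b.used)
    (hb : ClientEffect G (γ.view s) b c) : ClientCorrect P (γ.put s b) c := by
  rcases hb with ⟨hr, hone, hold⟩ | ⟨e, he, hc, v, -, hr, hno⟩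
  · have hr' : (γ.put s b).resps c = γ.resps c := hr
    have old : ∀ p, ∀ e' ∈ ((γ.put s b).srv p).readL, e'.client = some c →
        ∃ e ∈ (γ.srv p).readL, e.client = some c ∧ e.opid = e'.opid ∧ e.obj = e'.obj := by
      intro p e' he' hc'
      by_cases hp : p = s
      · subst hp
        rw [Config.put_srv_self] at he'
        exact hold e' he' hc'
      · rw [Config.put_srv_of_ne _ _ hp] at he'
        exact ⟨e', he', hc', rfl, rfl⟩
    refine ⟨h.reqs, hr' ▸ h.resps, fun p e' he' hc' => ?_, hr' ▸ h.resps_unique, fun p => ?_,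
      hr' ▸ h.resps_of_reqs, fun hq p e' he' hc' => ?_, fun p e' he' hc' => ?_,
      fun q hq => hu (h.used q hq)⟩
    · obtain ⟨e, he, hc, h₁, h₂⟩ := old p e' he' hc'
      rw [← h₁, ← h₂]
      exact h.reads p e he hc
    · by_cases hp : p = s
      · subst hp
        rwa [Config.put_srv_self]
      · rw [Config.put_srv_of_ne _ _ hp]
        exact h.reads_unique p
    · obtain ⟨e, he, hc, -⟩ := old p e' he' hc'
      exact h.reads_of_reqs hq p e he hc
    · obtain ⟨e, he, hc, -⟩ := old p e' he' hc'
      rw [hr']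
      exact h.resps_of_reads p e he hc
  · obtain ⟨hs, hp⟩ := h.reads s e he hc
    have hr' : (γ.put s b).resps c = {.readReturn e.opid v} := by
      have : γ.resps c = ∅ := h.resps_of_reads s e he hc
      change b.resps c = _
      rw [hr]
      simp [Config.view, this]
    have none' : ∀ p, ∀ e' ∈ ((γ.put s b).srv p).readL, e'.client ≠ some c := by
      intro p e' he' hc'
      by_cases hps : p = s
      · subst hps
        rw [Config.put_srv_self] at he'
        exact hno e' he' hc'
      · rw [Config.put_srv_of_ne _ _ hps] at he'
        -- Entries of a client live only at its home server, which is `s`.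
        exact hps ((h.reads p e' he' hc').1.trans hs.symm)
    refine ⟨h.reqs, ?_, fun p e' he' hc' => absurd hc' (none' p e' he'), ?_,
      fun p e' he' _ _ hc' => absurd hc' (none' p e' he'), ?_, fun _ => none',
      fun p e' he' hc' => absurd hc' (none' p e' he'), fun q hq => hu (h.used q hq)⟩
    · rw [hr']
      rintro r rfl
      exact ⟨_, _, hp, v, rfl⟩
    · rw [hr']
      exact Set.subsingleton_singleton
    · intro hq
      exact absurd hc (h.reads_of_reqs hq s e he)

theorem ClientCorrect.put_of_requestEffect {γ : Config K V W C I} {c : C}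
    (h : ClientCorrect P γ c) {s : Fin N} {b : Loc K V W C I s} (hu : γ.used ⊆ b.used)
    (hb : RequestEffect P G γ b c) : ClientCorrect P (γ.put s b) c := by
  obtain ⟨hs, hq, -, hn, o, op, hp, hb⟩ := hb
  have hq' : ¬ ((γ.put s b).reqs c).Nonempty := by
    change ¬ (γ.reqs c).Nonempty
    simp [hq]
  have hnew : ∀ p, ∀ e ∈ ((γ.put s b).srv p).readL, e.client = some c → p = s ∧ e ∈ b.st.readL := by
    intro p e he hc
    by_cases hps : p = s
    · subst hps
      rw [Config.put_srv_self] at he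
      exact ⟨rfl, he⟩
    · rw [Config.put_srv_of_ne _ _ hps] at he
      exact absurd hc (hn p e he)
  rcases hb with ⟨r, hr, ha, -, hno⟩ | ⟨hr, X, rfl, hone, hid⟩
  · have hr' : (γ.put s b).resps c = {r} := hr
    have none' : ∀ p, ∀ e' ∈ ((γ.put s b).srv p).readL, e'.client ≠ some c :=
      fun p e' he' hc' => hno e' (hnew p e' he' hc').2 hc'
    refine ⟨h.reqs, ?_, fun p e' he' hc' => absurd hc' (none' p e' he'), ?_,
      fun p e' he' _ _ hc' => absurd hc' (none' p e' he'), fun h' => absurd h' hq',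
      fun _ => none', fun p e' he' hc' => absurd hc' (none' p e' he'),
      fun q hq => hu (h.used q hq)⟩
    · rw [hr']
      rintro _ rfl
      exact ⟨_, _, hp, ha⟩
    · rw [hr']
      exact Set.subsingleton_singleton
  · have hr' : (γ.put s b).resps c = ∅ := hr
    refine ⟨h.reqs, ?_, fun p e he hc => ?_, ?_, fun p e he f hf hc hd => ?_,
      fun h' => absurd h' hq', fun h' => absurd h' hq', fun _ _ _ _ => hr',
      fun q hq => hu (h.used q hq)⟩
    · rw [hr']
      rintro _ ⟨⟩
    · obtain ⟨rfl, he⟩ := hnew p e he hc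
      obtain ⟨h₁, h₂⟩ := hid e he hc
      exact ⟨hs.symm, by rw [h₁, h₂]; exact hp⟩
    · rw [hr']
      exact Set.subsingleton_empty
    · exact hone e (hnew p e he hc).2 f (hnew p f hf hd).2 hc hd

/-- A transition of server `s` in the composed system. -/
theorem Correct.put {γ : Config K V W C I} {s : Fin N} {b : Loc K V W C I s}
    {α : Action N K V C I} (hG : IsVersioning G) (hsrv : ∀ p, ServerCorrect P G (γ.srv p))
    (hchan : ∀ i j, ∀ m ∈ γ.chan i j, MsgCorrect P G m)
    (hclock : ∀ i p, (γ.srv i).vc p ≤ (γ.srv p).vc p)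
    (hver : ∀ X t v, G X t v → ∀ p, t.ts p ≤ ((γ.put s b).srv p).vc p)
    (hcl : ∀ c, ClientCorrect P γ c) (hb : ServerEffect P G (γ.view s) b)
    (hcb : ∀ c, ClientEffect G (γ.view s) b c ∨ RequestEffect P G γ b c) :
    Correct P G (γ.put s b) ∧ StepEffect P G γ α (γ.put s b) := by
  have hvc : ∀ p, (γ.srv p).vc ≤ ((γ.put s b).srv p).vc := by
    intro p
    by_cases hp : p = s
    · subst hp
      rw [Config.put_srv_self]
      exact hb.vc_le
    · rw [Config.put_srv_of_ne _ _ hp]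
  refine ⟨⟨hG, fun p => ?_, fun i j m hm => ?_, fun i p => ?_, hver, fun c => ?_⟩,
    ⟨hvc, hb.used, fun c r hr => Or.inl ?_, fun c o op h => Or.inl h, fun c o op h => Or.inl h,
      fun c r hr hr' o op hp => ?_⟩⟩
  · by_cases hp : p = s
    · subst hp
      rw [Config.put_srv_self]
      exact hb.correct
    · rw [Config.put_srv_of_ne _ _ hp]
      exact hsrv p
  · by_cases hi : i = s
    · subst hi
      have hm' : m ∈ b.out j := by simpa [Config.put] using hm
      exact (hb.out j m hm').elim (hchan i j m) id
    · exact hchan i j m (by simpa [Config.put, Function.update_of_ne hi] using hm)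
  · by_cases hi : i = s
    · subst hi
      rw [Config.put_srv_self]
      -- Server `s` learns a larger component `p` only from the timestamp of a version, and these
      -- are bounded by the clock of `p` itself.
      rcases hb.vc_source p with h | ⟨X, t, v, hv, h⟩
      · exact h.trans ((hclock i p).trans (hvc p p))
      · exact h.trans (hver X t v hv p)
    · rw [Config.put_srv_of_ne _ _ hi]
      exact (hclock i p).trans (hvc p p)
  · rcases hcb c with h | h
    exacts [(hcl c).put_of_clientEffect hb.used h, (hcl c).put_of_requestEffect hb.used h]
  · change r ∈ b.resps c
    rcases hcb c with (⟨h, -⟩ | ⟨e, -, -, v, -, h, -⟩) | ⟨-, -, h, -⟩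
    · rw [h]; exact hr
    · rw [h]; exact Or.inl hr
    · rw [h] at hr; exact absurd hr (by simp)
  · have hr₁ : r ∈ b.resps c := hr
    have hp₁ : γ.pending c = some (o, op) := hp
    rcases hcb c with (⟨h, -⟩ | ⟨e, he, hc, v, ⟨t, ht, hle⟩, h, -⟩) |
      ⟨hs, -, -, -, o', op', hp', h⟩
    · rw [h] at hr₁; exact absurd hr₁ hr'
    · rw [h] at hr₁
      obtain ⟨rfl, hpe⟩ := (hcl c).reads s e he hc
      rw [hp₁] at hpe
      obtain ⟨rfl, rfl⟩ : o = e.opid ∧ op = .read e.obj := by simpa using hpe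
      rcases hr₁ with hr₁ | rfl
      · exact absurd hr₁ hr'
      · rw [Config.put_srv_self]
        exact ⟨_, v, t, rfl, ht, hle⟩
    · subst hs
      rw [hp₁] at hp'
      obtain ⟨rfl, rfl⟩ : o = o' ∧ op = op' := by simpa using hp'
      rcases h with ⟨r', h, -, hok, -⟩ | ⟨h, -⟩
      · rw [h] at hr₁
        obtain rfl := hr₁
        rwa [Config.put_srv_self]
      · rw [h] at hr₁; exact absurd hr₁ (by simp)

/-- The versions after the action `α` that leads to the state `γ'`: a write request creates a new
version. -/
def nextVersions (P : Params N K F V W C) (G : Fin K → Tag N → V → Prop)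
    (α : Action N K V C I) (γ' : Config K V W C I) (X : Fin K) (t : Tag N) (v : V) : Prop :=
  G X t v ∨ ∃ c o, α = .request c o (.write X v) ∧ t = ⟨(γ'.srv (P.home c)).vc, P.cid c⟩

theorem nextVersions_eq {α : Action N K V C I} {γ' : Config K V W C I}
    (h : ∀ c o X v, α ≠ .request c o (.write X v)) : nextVersions P G α γ' = G := by
  funext X t v
  simp [nextVersions, h]

theorem put_vc_le {γ : Config K V W C I} {s : Fin N} {b : Loc K V W C I s}
    (h : (γ.srv s).vc ≤ b.st.vc) (p : Fin N) : (γ.srv p).vc ≤ ((γ.put s b).srv p).vc := by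
  by_cases hp : p = s
  · subst hp
    rwa [Config.put_srv_self]
  · rw [Config.put_srv_of_ne _ _ hp]

/-- A transition of server `s` that does not receive a request. -/
theorem Correct.put_of_effect {γ : Config K V W C I} {s : Fin N} {b : Loc K V W C I s}
    {α : Action N K V C I} (h : Correct P G γ) (hb : ServerEffect P G (γ.view s) b)
    (hcb : ∀ c, ClientEffect G (γ.view s) b c) :
    Correct P G (γ.put s b) ∧ StepEffect P G γ α (γ.put s b) :=
  Correct.put h.versioning h.server h.chan h.clock
    (fun X t v hv p => (h.version_le X t v hv p).trans (put_vc_le hb.vc_le p p))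
    h.client hb (fun c => Or.inl (hcb c))

/-- The requests of a client can be removed. -/
theorem ClientCorrect.removeReq {γ : Config K V W C I} {c : C} (h : ClientCorrect P γ c)
    {Q : C → Set (I × Op K V)} (hQ : Q c ⊆ γ.reqs c) : ClientCorrect P { γ with reqs := Q } c :=
  ⟨fun q hq => h.reqs q (hQ hq), h.resps, h.reads, h.resps_unique, h.reads_unique,
    fun hq => h.resps_of_reqs (hq.mono hQ), fun hq => h.reads_of_reqs (hq.mono hQ),
    h.resps_of_reads, h.used⟩

theorem ClientCorrect.reqs_diff {γ : Config K V W C I} {c : C} (h : ClientCorrect P γ c)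
    {q : I × Op K V} (hq : q ∈ γ.reqs c) : γ.reqs c \ {q} = ∅ := by
  ext q'
  simp only [Set.mem_sdiff, Set.mem_singleton_iff, Set.mem_empty_iff_false, iff_false, not_and,
    not_not]
  intro hq'
  simpa using (h.reqs q' hq').symm.trans (h.reqs q hq)

/-- The substantial case is a write, the only transition that creates a version. The invariant
survives because the new tag is fresh and the clock of each server dominates its component of the
new timestamp. -/
theorem Correct.request {γ γ' : Config K V W C I} (h : Correct P G γ) {c : C} {o : I}
    {op : Op K V} (hs : Step P γ (.request c o op) γ') :
    Correct P (nextVersions P G (.request c o op) γ') γ' ∧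
      StepEffect P (nextVersions P G (.request c o op) γ') γ (.request c o op) γ' := by
  obtain ⟨-, hreq, b, hb, rfl⟩ := hs
  set γ₁ : Config K V W C I :=
    { γ with reqs := Function.update γ.reqs c (γ.reqs c \ {(o, op)}) } with hγ₁
  have hcl₁ : ∀ c', ClientCorrect P γ₁ c' := fun c' => (h.client c').removeReq (by
    by_cases e : c' = c
    · subst e; simp
    · simp [Function.update_of_ne e])
  have hq₁ : γ₁.reqs c = ∅ := by
    simp [hγ₁, (h.client c).reqs_diff hreq]
  have hr₁ : γ₁.resps c = ∅ := (h.client c).resps_of_reqs ⟨_, hreq⟩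
  have hn₁ : ∀ p, ∀ e ∈ (γ₁.srv p).readL, e.client ≠ some c :=
    (h.client c).reads_of_reqs ⟨_, hreq⟩
  have hp₁ : γ₁.pending c = some (o, op) := (h.client c).reqs _ hreq
  have hu₁ : ∀ c', AtMostOneRead (γ₁.srv (P.home c)).readL c' :=
    fun c' => (hcl₁ c').reads_unique _
  change onRequest P (P.home c) c o op (γ₁.view (P.home c)) b at hb
  -- Dropping the received request is not visible in the step effect, so the state without it can
  -- serve as the starting point.
  suffices H : Correct P (nextVersions P G (.request c o op) (γ₁.put (P.home c) b))
      (γ₁.put (P.home c) b) ∧ StepEffect P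
        (nextVersions P G (.request c o op) (γ₁.put (P.home c) b)) γ₁ (.request c o op)
        (γ₁.put (P.home c) b) from
    ⟨H.1, ⟨H.2.vc_le, H.2.used, H.2.resp_keep, H.2.pending_keep, H.2.pending_new, H.2.resp_new⟩⟩
  cases op with
  | write X v =>
    set G' := nextVersions P G (.request c o (.write X v)) (γ₁.put (P.home c) b) with hG'
    have hsub : ∀ X t v, G X t v → G' X t v := fun X t v hv => Or.inl hv
    have hvc := onWrite_vc hb
    change b.st.vc = Function.update (γ.srv (P.home c)).vc (P.home c)
      ((γ.srv (P.home c)).vc (P.home c) + 1) at hvc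
    have hlt : (γ.srv (P.home c)).vc < b.st.vc := by
      rw [hvc]
      exact lt_update_self_iff.2 (Nat.lt_succ_self _)
    have hnew : G' X ⟨b.st.vc, P.cid c⟩ v :=
      Or.inr ⟨c, o, rfl, by rw [Config.put_srv_self]⟩
    have inv : ∀ Y t w, G' Y t w →
        G Y t w ∨ (Y = X ∧ w = v ∧ t = ⟨b.st.vc, P.cid c⟩) := by
      rintro Y t w (hw | ⟨c', o', he, ht⟩)
      · exact Or.inl hw
      · simp only [Action.request.injEq, Op.write.injEq] at he
        obtain ⟨rfl, -, rfl, rfl⟩ := he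
        rw [Config.put_srv_self] at ht
        exact Or.inr ⟨rfl, rfl, ht⟩
    -- Existing tags are bounded in the component of the writing server by its clock, which the
    -- write raises by one.
    have fresh : ∀ Y w, ¬ G Y ⟨b.st.vc, P.cid c⟩ w := by
      intro Y w hw
      have := h.version_le _ _ _ hw (P.home c)
      rw [hvc] at this
      simp at this
    have hvG' : IsVersioning G' := by
      refine ⟨fun Y => Or.inl (h.versioning.zero Y), fun {Y t w w'} hw hw' => ?_⟩
      rcases inv _ _ _ hw with h₁ | ⟨-, e₁, t₁⟩ <;> rcases inv _ _ _ hw' with h₂ | ⟨-, e₂, t₂⟩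
      · exact h.versioning.unique h₁ h₂
      · exact absurd (t₂ ▸ h₁) (fresh _ _)
      · exact absurd (t₁ ▸ h₂) (fresh _ _)
      · rw [e₁, e₂]
    have hsc : ∀ p, ServerCorrect P G' (γ₁.srv p) := fun p => (h.server p).mono hsub
    have heff : ServerEffect P G' (γ₁.view (P.home c)) b :=
      onWrite_serverEffect (hsc (P.home c)) hb hnew
    refine Correct.put hvG' hsc (fun i j m hm => (h.chan i j m hm).mono hsub) h.clock ?_ hcl₁ heff
      fun c' => ?_
    -- For the new timestamp, the writer's own component is its new clock value, and any other
    -- component is knowledge about `p`, bounded by the clock of `p`.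
    · intro Y t w hw p
      have hle := put_vc_le (γ := γ₁) (b := b) hlt.le p p
      rcases inv _ _ _ hw with hw | ⟨-, -, rfl⟩
      · exact (h.version_le Y t w hw p).trans hle
      · by_cases hp : p = P.home c
        · subst hp
          rw [Config.put_srv_self]
        · refine le_trans ?_ hle
          change b.st.vc p ≤ _
          rw [hvc, Function.update_of_ne hp]
          exact h.clock _ p
    · by_cases hc : c' = c
      · subst hc
        obtain ⟨h₁, h₂⟩ := onWrite_client (hn₁ _) hb
        refine Or.inr ⟨rfl, hq₁, hr₁, hn₁, o, _, hp₁, Or.inl ⟨.writeAck o, ?_, rfl, hlt, h₂⟩⟩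
        rw [h₁]
        simp [Config.view, hr₁]
      · exact Or.inl (onWrite_clientEffect (hu₁ c') hb hnew hc)
  | read X =>
    rw [nextVersions_eq (by simp)]
    have heff : ServerEffect P G (γ₁.view (P.home c)) b := onRead_serverEffect (h.server _) hb
    refine Correct.put h.versioning h.server h.chan h.clock
      (fun Y t w hw p => (h.version_le Y t w hw p).trans (put_vc_le (γ := γ₁) heff.vc_le p p))
      hcl₁ heff fun c' => ?_
    by_cases hc : c' = c
    · subst hc
      refine Or.inr ⟨rfl, hq₁, hr₁, hn₁, o, _, hp₁, ?_⟩
      rcases onRead_cases (h.server _) hb with ⟨v, ⟨t, hv, ht⟩, rfl⟩ | rfl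
      · refine Or.inl ⟨.readReturn o v, ?_, ⟨v, rfl⟩, ⟨o, v, t, rfl, hv, ht⟩, hn₁ _⟩
        simp [Loc.reply, Config.view, hr₁]
      · have old : ∀ e ∈ (γ₁.srv (P.home c')).readL ∪ {⟨some c', o, X,
            (γ₁.srv (P.home c')).M.tagvec, onlyAt _ (γ₁.srv (P.home c')).M.val⟩},
            e.client = some c' → e = ⟨some c', o, X,
            (γ₁.srv (P.home c')).M.tagvec, onlyAt _ (γ₁.srv (P.home c')).M.val⟩ := by
          rintro e (he | he) hec
          exacts [absurd hec (hn₁ _ e he), he]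
        refine Or.inr ⟨hr₁, X, rfl, fun e he e' he' hec hec' => ?_, fun e he hec => ?_⟩
        · rw [old e he hec, old e' he' hec']
        · rw [old e he hec]
          exact ⟨rfl, rfl⟩
    · exact Or.inl (onRead_clientEffect (h.server _) (hu₁ c') hb hc)

theorem Correct.invoke {γ γ' : Config K V W C I} (h : Correct P G γ) {c : C} {o : I}
    {op : Op K V} (hs : Step P γ (.invoke c o op) γ') :
    Correct P G γ' ∧ StepEffect P G γ (.invoke c o op) γ' := by
  obtain ⟨-, hp, ho, rfl⟩ := hs
  have hreads : ∀ p, ∀ e ∈ (γ.srv p).readL, e.client ≠ some c := fun p e he hc => by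
    simpa [hp] using ((h.client c).reads p e he hc).2
  have hresps : γ.resps c = ∅ := by
    rw [Set.eq_empty_iff_forall_notMem]
    intro r hr
    obtain ⟨o', op', hp', -⟩ := (h.client c).resps r hr
    simp [hp] at hp'
  have hreqs : γ.reqs c = ∅ := by
    rw [Set.eq_empty_iff_forall_notMem]
    intro q hq
    simpa [hp] using (h.client c).reqs q hq
  refine ⟨⟨h.versioning, h.server, h.chan, h.clock, h.version_le, fun c' => ?_⟩,
    ⟨fun _ => le_rfl, Set.subset_union_left, fun _ _ hr => Or.inl hr, fun c' o' op' hp' => ?_,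
      fun c' o' op' hp' => ?_, fun _ _ hr hr' => absurd hr hr'⟩⟩
  · by_cases hc : c' = c
    · subst hc
      refine ⟨?_, ?_, fun p e he hc => absurd hc (hreads p e he), (h.client c').resps_unique,
        (h.client c').reads_unique, fun _ => hresps, fun _ => hreads, fun _ _ _ _ => hresps, ?_⟩
      · simp [hreqs]
      · simp [hresps]
      · rintro q hq
        obtain rfl : (o, op) = q := by simpa using hq
        exact Or.inr rfl
    · obtain ⟨i₁, i₂, i₃, i₄, i₅, i₆, i₇, i₈, i₉⟩ := h.client c'
      constructor <;> simp only [Function.update_of_ne hc] <;> try assumption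
      exact fun q hq => Or.inl (i₉ q hq)
  · left
    by_cases hc : c' = c
    · subst hc; simp [hp] at hp'
    · simpa [Function.update_of_ne hc] using hp'
  · by_cases hc : c' = c
    · subst hc
      obtain ⟨rfl, rfl⟩ : o = o' ∧ op = op' := by simpa using hp'
      exact Or.inr ⟨rfl, ho⟩
    · left
      simpa [Function.update_of_ne hc] using hp'

theorem Correct.respond {γ γ' : Config K V W C I} (h : Correct P G γ) {c : C} {r : Resp V I}
    (hs : Step P γ (.respond c r) γ') :
    Correct P G γ' ∧ StepEffect P G γ (.respond c r) γ' := by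
  obtain ⟨-, hr, rfl⟩ := hs
  -- A response in transit always answers the pending operation, so receiving it completes that
  -- operation.
  obtain ⟨o, op, hp, ha⟩ := (h.client c).resps r hr
  rw [if_pos ⟨o, op, hp, ha⟩]
  have hempty : γ.resps c \ {r} = ∅ := by
    rw [(h.client c).resps_unique.eq_singleton_of_mem hr]
    simp
  refine ⟨⟨h.versioning, h.server, h.chan, h.clock, h.version_le, fun c' => ?_⟩,
    ⟨fun _ => le_rfl, subset_rfl, fun c' r' hr' => ?_, fun c' o' op' hp' => ?_,
      fun c' o' op' hp' => ?_, fun c' r' hr' hn => ?_⟩⟩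
  · by_cases hc : c' = c
    · subst hc
      have hreqs : γ.reqs c' = ∅ := by
        by_contra hne
        have := (h.client c').resps_of_reqs (Set.nonempty_iff_ne_empty.2 hne)
        simp [this] at hr
      have hreads : ∀ p, ∀ e ∈ (γ.srv p).readL, e.client ≠ some c' := fun p e he hc => by
        have := (h.client c').resps_of_reads p e he hc
        simp [this] at hr
      refine ⟨by simp [hreqs], by simp [hempty], fun p e he hc => absurd hc (hreads p e he),
        by simp [hempty], (h.client c').reads_unique, by simp [hempty], fun _ => hreads,
        by simp [hempty], by simp⟩
    · obtain ⟨i₁, i₂, i₃, i₄, i₅, i₆, i₇, i₈, i₉⟩ := h.client c'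
      constructor <;> simp only [Function.update_of_ne hc] <;> assumption
  · by_cases hc : c' = c
    · subst hc; simp
    · left; simpa [Function.update_of_ne hc] using hr'
  · by_cases hc : c' = c
    · subst hc
      rw [hp] at hp'
      obtain ⟨rfl, rfl⟩ : o = o' ∧ op = op' := by simpa using hp'
      exact Or.inr ⟨r, hr, ha⟩
    · left; simpa [Function.update_of_ne hc] using hp'
  · left
    by_cases hc : c' = c
    · subst hc; simp at hp'
    · simpa [Function.update_of_ne hc] using hp'
  · refine absurd ?_ hn
    by_cases hc : c' = c
    · subst hc; simp [hempty] at hr'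
    · simpa [Function.update_of_ne hc] using hr'

theorem Correct.receive {γ γ' : Config K V W C I} (h : Correct P G γ) {i s : Fin N}
    (hs : Step P γ (.receive i s) γ') :
    Correct P G γ' ∧ StepEffect P G γ (.receive i s) γ' := by
  obtain ⟨-, his, m, rest, b, hm, hb, rfl⟩ := hs
  set γ₁ : Config K V W C I :=
    { γ with chan := Function.update γ.chan i (Function.update (γ.chan i) s rest) } with hγ₁
  -- Consuming the message changes a channel out of `i`, and `i ≠ s`, so the part that belongs to
  -- `s` is the same.
  have hview : γ.view s = γ₁.view s := by
    simp [hγ₁, Config.view, Function.update_of_ne his.symm]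
  rw [hview] at hb
  have h₁ : Correct P G γ₁ := by
    refine ⟨h.versioning, h.server, fun i' j m' hm' => ?_, h.clock, h.version_le, fun c => ?_⟩
    · refine h.chan i' j m' ?_
      by_cases hi : i' = i
      · subst hi
        by_cases hj : j = s
        · subst hj
          rw [hm]
          simp only [hγ₁, Function.update_self] at hm'
          exact List.mem_cons_of_mem _ hm'
        · simpa [hγ₁, Function.update_of_ne hj] using hm'
      · simpa [hγ₁, Function.update_of_ne hi] using hm'
    · obtain ⟨i₁, i₂, i₃, i₄, i₅, i₆, i₇, i₈, i₉⟩ := h.client c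
      exact ⟨i₁, i₂, i₃, i₄, i₅, i₆, i₇, i₈, i₉⟩
  obtain ⟨e₁, e₂⟩ := onMsg_effect h.versioning (h₁.server s)
    (h.chan i s m (by simp [hm])) (fun c => (h₁.client c).reads_unique s) hb
  obtain ⟨H₁, H₂⟩ := h₁.put_of_effect (α := .receive i s) e₁ e₂
  exact ⟨H₁, ⟨H₂.vc_le, H₂.used, H₂.resp_keep, H₂.pending_keep, H₂.pending_new, H₂.resp_new⟩⟩

theorem Correct.step {γ γ' : Config K V W C I} (h : Correct P G γ) {α : Action N K V C I}
    (hs : Step P γ α γ') :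
    Correct P (nextVersions P G α γ') γ' ∧ StepEffect P (nextVersions P G α γ') γ α γ' := by
  have hone : ∀ s c, AtMostOneRead (γ.srv s).readL c := fun s c => (h.client c).reads_unique s
  by_cases hα : ∃ c o op, α = .request c o op
  · obtain ⟨c, o, op, rfl⟩ := hα
    exact h.request hs
  rw [nextVersions_eq (fun c o X v e => hα ⟨c, o, _, e⟩)]
  cases α with
  | request c o op => exact absurd ⟨c, o, op, rfl⟩ hα
  | invoke c o op => exact h.invoke hs
  | respond c r => exact h.respond hs
  | receive i s => exact h.receive hs
  | applyInQueue s =>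
    obtain ⟨-, b, hb, rfl⟩ := hs
    obtain ⟨e₁, e₂⟩ := applyInQueue_effect (h.server s) (hone s) hb
    exact h.put_of_effect e₁ e₂
  | encoding s =>
    obtain ⟨-, b, hb, rfl⟩ := hs
    obtain ⟨e₁, e₂⟩ := (encoding_quiet h.versioning hb).effect (h.server s) (hone s)
    exact h.put_of_effect e₁ e₂
  | garbageCollection s =>
    obtain ⟨-, b, hb, rfl⟩ := hs
    obtain ⟨e₁, e₂⟩ := (garbageCollection_quiet hb).effect (h.server s) (hone s)
    exact h.put_of_effect e₁ e₂
  | haltServer s =>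
    cases hs
    refine ⟨⟨h.versioning, h.server, h.chan, h.clock, h.version_le, fun c => ?_⟩,
      ⟨fun _ => le_rfl, subset_rfl, fun _ _ => Or.inl, fun _ _ _ => Or.inl, fun _ _ _ => Or.inl,
        fun _ _ hr hr' => absurd hr hr'⟩⟩
    obtain ⟨i₁, i₂, i₃, i₄, i₅, i₆, i₇, i₈, i₉⟩ := h.client c
    exact ⟨i₁, i₂, i₃, i₄, i₅, i₆, i₇, i₈, i₉⟩
  | haltClient c' =>
    cases hs
    refine ⟨⟨h.versioning, h.server, h.chan, h.clock, h.version_le, fun c => ?_⟩,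
      ⟨fun _ => le_rfl, subset_rfl, fun _ _ => Or.inl, fun _ _ _ => Or.inl, fun _ _ _ => Or.inl,
        fun _ _ hr hr' => absurd hr hr'⟩⟩
    obtain ⟨i₁, i₂, i₃, i₄, i₅, i₆, i₇, i₈, i₉⟩ := h.client c
    exact ⟨i₁, i₂, i₃, i₄, i₅, i₆, i₇, i₈, i₉⟩

end Global

/-! ### Executions: timestamps of operations, sources of reads, and the timestamp order. -/

section Executions

variable {N K : ℕ} {F : Type uF} {V : Type uV} {W : Fin N → Type uW} {C : Type uC} {I : Type uI}
  [Field F] [AddCommGroup V] [Module F V] [∀ i, AddCommGroup (W i)] [∀ i, Module F (W i)]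
  {P : Params N K F V W C}

/-! ### Executions -/

/-- The versions that exist at point `n` of an execution. -/
def versions (β : Execution P I) : ℕ → Fin K → Tag N → V → Prop
  | 0 => fun _ t v => t = 0 ∧ v = 0
  | n + 1 => nextVersions P (versions β n) (β.act n) (β.state (n + 1))

theorem Correct.initial :
    Correct P (fun _ t v => t = 0 ∧ v = 0) (Config.initial : Config K V W C I) where
  versioning := ⟨fun _ => ⟨rfl, rfl⟩, fun h h' => h.2.trans h'.2.symm⟩
  server := ServerCorrect.initial P fun _ => ⟨rfl, rfl⟩
  chan i j m hm := by simp [Config.initial] at hm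
  clock i p := le_rfl
  version_le := by
    rintro X t v ⟨rfl, -⟩ p
    exact le_rfl
  client c := by
    constructor <;> simp [Config.initial, ServerState.initial, AtMostOneRead]

theorem lt_of_succ_le_len {β : Execution P I} {n : ℕ} (h : ((n + 1 : ℕ) : ℕ∞) ≤ β.len) :
    (n : ℕ∞) < β.len :=
  lt_of_lt_of_le (by exact_mod_cast Nat.lt_succ_self n) h

theorem le_len_of_le {β : Execution P I} {m n : ℕ} (hmn : m ≤ n) (h : (n : ℕ∞) ≤ β.len) :
    (m : ℕ∞) ≤ β.len :=
  le_trans (by exact_mod_cast hmn) h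

theorem Execution.correct (β : Execution P I) (n : ℕ) (hn : (n : ℕ∞) ≤ β.len) :
    Correct P (versions β n) (β.state n) := by
  induction n with
  | zero =>
    rw [β.init_eq]
    exact Correct.initial
  | succ n ih =>
    have h := lt_of_succ_le_len hn
    exact ((ih h.le).step (β.step n h)).1

theorem Execution.stepEffect (β : Execution P I) {n : ℕ} (hn : (n : ℕ∞) < β.len) :
    StepEffect P (versions β (n + 1)) (β.state n) (β.act n) (β.state (n + 1)) :=
  ((β.correct n hn.le).step (β.step n hn)).2

theorem Execution.vc_mono (β : Execution P I) {m n : ℕ} (hmn : m ≤ n) (hn : (n : ℕ∞) ≤ β.len)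
    (s : Fin N) : ((β.state m).srv s).vc ≤ ((β.state n).srv s).vc := by
  induction n, hmn using Nat.le_induction with
  | base => exact le_rfl
  | succ n _ ih =>
    have h := lt_of_succ_le_len hn
    exact (ih h.le).trans ((β.stepEffect h).vc_le s)

theorem Execution.used_mono (β : Execution P I) {m n : ℕ} (hmn : m ≤ n) (hn : (n : ℕ∞) ≤ β.len) :
    (β.state m).used ⊆ (β.state n).used := by
  induction n, hmn using Nat.le_induction with
  | base => exact subset_rfl
  | succ n _ ih =>
    have h := lt_of_succ_le_len hn
    exact (ih h.le).trans (β.stepEffect h).used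

variable {β : Execution P I}

theorem exists_invoke_of_pending {n : ℕ} (hn : (n : ℕ∞) ≤ β.len) {c : C} {o : I} {op : Op K V}
    (h : (β.state n).pending c = some (o, op)) : ∃ i < n, β.act i = .invoke c o op := by
  induction n with
  | zero =>
    rw [β.init_eq] at h
    simp [Config.initial] at h
  | succ n ih =>
    have hlt := lt_of_succ_le_len hn
    rcases (β.stepEffect hlt).pending_new c o op h with h | ⟨h, -⟩
    · obtain ⟨i, hi, hact⟩ := ih hlt.le h
      exact ⟨i, hi.trans (Nat.lt_succ_self n), hact⟩
    · exact ⟨n, Nat.lt_succ_self n, h⟩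

theorem invoke_fresh {n : ℕ} (hn : (n : ℕ∞) < β.len) {c : C} {o : I} {op : Op K V}
    (h : β.act n = .invoke c o op) :
    (β.state n).pending c = none ∧ o ∉ (β.state n).used ∧ o ∈ (β.state (n + 1)).used ∧
      (β.state (n + 1)).pending c = some (o, op) := by
  have hs := β.step n hn
  rw [h] at hs
  obtain ⟨-, h₁, h₂, h₃⟩ := hs
  rw [h₃]
  exact ⟨h₁, h₂, Or.inr rfl, by simp⟩

/-- Identifiers stay used for ever and an invocation needs an unused one. -/
theorem invoke_unique {m n : ℕ} (hm : (m : ℕ∞) < β.len) (hn : (n : ℕ∞) < β.len) {c c' : C} {o : I}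
    {op op' : Op K V} (h : β.act m = .invoke c o op) (h' : β.act n = .invoke c' o op') :
    m = n := by
  rcases lt_trichotomy m n with hlt | rfl | hlt
  · exact absurd (β.used_mono hlt hn.le (invoke_fresh hm h).2.2.1) (invoke_fresh hn h').2.1
  · rfl
  · exact absurd (β.used_mono hlt hm.le (invoke_fresh hn h').2.2.1) (invoke_fresh hm h).2.1

theorem Resp.Answers.opid_eq {o o' : I} {op op' : Op K V} {r : Resp V I} (h : r.Answers o op)
    (h' : r.Answers o' op') : o = o' := by
  cases op <;> cases op' <;> simp only [Resp.Answers] at h h'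
  · rw [h] at h'; simpa using h'
  · obtain ⟨v, h'⟩ := h'; rw [h] at h'; simp at h'
  · obtain ⟨v, h⟩ := h; rw [h] at h'; simp at h'
  · obtain ⟨v, h⟩ := h
    obtain ⟨w, hw⟩ := h'
    rw [h, Resp.readReturn.injEq] at hw
    exact hw.1

/-- Between its invocation and its completion, a response that has been sent stays in transit. -/
theorem mem_resps_of_pending {m n : ℕ} (hmn : m ≤ n) (hn : (n : ℕ∞) ≤ β.len) {c : C} {o : I}
    {op : Op K V} {r : Resp V I} (hr : r ∈ (β.state m).resps c) (ha : r.Answers o op)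
    (hp : (β.state n).pending c = some (o, op)) : r ∈ (β.state n).resps c := by
  obtain ⟨o', op', hp', ha'⟩ := ((β.correct m (le_len_of_le hmn hn)).client c).resps r hr
  obtain rfl := ha.opid_eq ha'
  have hused := ((β.correct m (le_len_of_le hmn hn)).client c).used _ hp'
  induction n, hmn using Nat.le_induction with
  | base => exact hr
  | succ n hmn ih =>
    have hlt := lt_of_succ_le_len hn
    rcases (β.stepEffect hlt).pending_new c o op hp with h | ⟨-, h⟩
    · rcases (β.stepEffect hlt).resp_keep c r (ih hlt.le h) with h' | h'
      · exact h'
      · rw [hp] at h'; simp at h'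
    -- If the operation became pending only now, its identifier would have to be fresh, but it was
    -- already used when the response was in transit.
    · exact absurd (β.used_mono hmn hlt.le hused) h

/-! ### Responses and timestamps of invocations -/

/-- The response answers the currently pending operation; identifiers are unique, so that operation
is `π` itself. -/
theorem Invocation.ResponseAt.pending {π : Invocation β} {n : ℕ} (h : π.ResponseAt n)
    (hn : (n : ℕ∞) ≤ β.len) :
    π.idx < n ∧ (β.state n).pending π.client = some (π.opid, π.op) := by
  obtain ⟨r, hr, ha⟩ := h
  obtain ⟨o, op, hp, ha'⟩ := ((β.correct n hn).client π.client).resps r hr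
  obtain rfl := ha.opid_eq ha'
  obtain ⟨i, hi, hact⟩ := exists_invoke_of_pending hn hp
  have hi' : (i : ℕ∞) < β.len := lt_of_lt_of_le (by exact_mod_cast hi) hn
  have := invoke_unique hi' π.idx_lt hact π.act_eq
  subst this
  have h' := π.act_eq
  rw [hact] at h'
  simp only [Action.invoke.injEq, true_and] at h'
  rw [← h']
  exact ⟨hi, hp⟩

/-- `n` is the first point at which a response to `π` has been sent. -/
def Invocation.FirstResponse (π : Invocation β) (n : ℕ) : Prop :=
  (n : ℕ∞) ≤ β.len ∧ π.ResponseAt n ∧ ∀ m < n, ¬ π.ResponseAt m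

theorem Invocation.FirstResponse.unique {π : Invocation β} {m n : ℕ} (hm : π.FirstResponse m)
    (hn : π.FirstResponse n) : m = n := by
  rcases lt_trichotomy m n with h | h | h
  exacts [absurd hm.2.1 (hn.2.2 m h), h, absurd hn.2.1 (hm.2.2 n h)]

theorem Invocation.exists_firstResponse {π : Invocation β} {n : ℕ} (hn : (n : ℕ∞) ≤ β.len)
    (h : π.ResponseAt n) : ∃ m ≤ n, π.FirstResponse m := by
  have hex : ∃ n, π.ResponseAt n := ⟨n, h⟩
  have hle := Nat.find_min' hex h
  exact ⟨Nat.find hex, hle, le_len_of_le hle hn, Nat.find_spec hex, fun m => Nat.find_min hex⟩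

theorem Invocation.hasTimestamp_iff {π : Invocation β} {T : Fin N → ℕ} :
    (Operation.invoked π).HasTimestamp T ↔
      ∃ n, π.FirstResponse n ∧ T = ((β.state n).srv (P.home π.client)).vc := by
  simp [Operation.HasTimestamp, Invocation.FirstResponse, and_assoc]

theorem Operation.HasTimestamp.unique {π : Operation β} {T T' : Fin N → ℕ}
    (h : π.HasTimestamp T) (h' : π.HasTimestamp T') : T = T' := by
  cases π with
  | initial X => exact Eq.trans h (Eq.symm h')
  | invoked π =>
    obtain ⟨n, hn, rfl⟩ := Invocation.hasTimestamp_iff.1 h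
    obtain ⟨m, hm, rfl⟩ := Invocation.hasTimestamp_iff.1 h'
    rw [hn.unique hm]

/-- The first response to an operation is correct when it is sent. -/
theorem Invocation.FirstResponse.respCorrect {π : Invocation β} {n : ℕ}
    (h : π.FirstResponse n) {r : Resp V I} (hr : r ∈ (β.state n).resps π.client)
    (ha : r.Answers π.opid π.op) :
    ∃ k, n = k + 1 ∧ π.idx ≤ k ∧ RespCorrect (versions β n)
      ((β.state k).srv (P.home π.client)).vc ((β.state n).srv (P.home π.client)).vc π.op r := by
  obtain ⟨hn, hres, hmin⟩ := h
  obtain ⟨hidx, hp⟩ := hres.pending hn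
  -- The invocation precedes the response, so `n` is positive, and the response is sent in the
  -- transition from `k` to `k + 1`.
  obtain ⟨k, rfl⟩ : ∃ k, n = k + 1 := ⟨n - 1, by omega⟩
  exact ⟨k, rfl, Nat.lt_succ_iff.1 hidx, (β.stepEffect (lt_of_succ_le_len hn)).resp_new _ r hr
    (fun hk => hmin k (Nat.lt_succ_self k) ⟨r, hk, ha⟩) _ _ hp⟩

/-- Every version comes from a write with the corresponding timestamp. -/
theorem exists_write_of_versions {n : ℕ} (hn : (n : ℕ∞) ≤ β.len) {X : Fin K} {t : Tag N} {v : V}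
    (h : versions β n X t v) : ∃ φ : Operation β, φ.IsWrite X v ∧ φ.HasTimestamp t.ts := by
  induction n with
  | zero =>
    obtain ⟨rfl, rfl⟩ := h
    exact ⟨.initial X, ⟨rfl, rfl⟩, rfl⟩
  | succ n ih =>
    have hlt := lt_of_succ_le_len hn
    rcases h with h | ⟨c, o, hact, rfl⟩
    · exact ih hlt.le h
    have hs := β.step n hlt
    rw [hact] at hs
    obtain ⟨-, hreq, b, hb, hst⟩ := hs
    have hcl := (β.correct n hlt.le).client c
    have hp := hcl.reqs _ hreq
    obtain ⟨i, hi, hinv⟩ := exists_invoke_of_pending hlt.le hp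
    let π : Invocation β := ⟨i, c, o, .write X v, lt_trans (by exact_mod_cast hi) hlt, hinv⟩
    refine ⟨.invoked π, rfl, Invocation.hasTimestamp_iff.2 ⟨n + 1, ⟨hn, ?_, ?_⟩, rfl⟩⟩
    · refine ⟨.writeAck o, ?_, rfl⟩
      have := (onWrite_client (hcl.reads_of_reqs ⟨_, hreq⟩ _) hb).1
      rw [hst]
      change _ ∈ b.resps c
      rw [this]
      exact Or.inr rfl
    -- An earlier response would still be in transit at point `n`, but a client with an unprocessed
    -- request has no response in transit.
    · rintro m hm ⟨r, hr, ha⟩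
      have := mem_resps_of_pending (Nat.lt_succ_iff.1 hm) hlt.le hr ha hp
      rw [hcl.resps_of_reqs ⟨_, hreq⟩] at this
      exact this

/-- A completed read has a timestamp, and it returns the value of a write whose timestamp is not
larger. -/
theorem exists_write_of_returns {π : Operation β} {X : Fin K} {v : V} (hX : π.IsRead X)
    (hv : π.Returns v) : ∃ T, π.HasTimestamp T ∧
      ∃ (φ : Operation β) (T' : Fin N → ℕ), φ.IsWrite X v ∧ φ.HasTimestamp T' ∧ T' ≤ T := by
  cases π with
  | initial Y => exact absurd hX id
  | invoked π =>
    obtain ⟨-, n, hn, hp, hact⟩ := hv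
    have hop : π.op = .read X := hX
    have hs := β.step n hn
    rw [hact] at hs
    have hr := hs.2.1
    have ha : (Resp.readReturn π.opid v : Resp V I).Answers π.opid π.op := by
      rw [hop]; exact ⟨v, rfl⟩
    obtain ⟨m, hmn, hm⟩ := Invocation.exists_firstResponse hn.le ⟨_, hr, ha⟩
    obtain ⟨r', hr', ha'⟩ := hm.2.1
    -- The timestamp is taken at the first response, while the returned value comes from the
    -- delivered one. They coincide: the first response stays in transit until completion, and a
    -- client never has two.
    obtain rfl := ((β.correct n hn.le).client π.client).resps_unique
      (mem_resps_of_pending hmn hn.le hr' ha' hp) hr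
    obtain ⟨k, -, -, hc⟩ := hm.respCorrect hr' ha'
    rw [hop] at hc
    obtain ⟨o, v', t, he, ht, hle⟩ := hc
    simp only [Resp.readReturn.injEq] at he
    obtain ⟨-, rfl⟩ := he
    obtain ⟨φ, hφ, hφt⟩ := exists_write_of_versions hm.1 ht
    exact ⟨_, Invocation.hasTimestamp_iff.2 ⟨m, hm, rfl⟩, φ, t.ts, hφ, hφt, hle⟩

/-- An operation is answered before its client invokes the next one. -/
theorem exists_firstResponse_of_lt {π₁ π₂ : Invocation β} (hc : π₁.client = π₂.client)
    (hlt : π₁.idx < π₂.idx) : ∃ n ≤ π₂.idx, π₁.FirstResponse n := by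
  by_contra hno
  have hno' : ∀ n ≤ π₂.idx, ¬ π₁.ResponseAt n := by
    intro n hn hr
    obtain ⟨m, hm, hm'⟩ := Invocation.exists_firstResponse
      (le_len_of_le hn π₂.idx_lt.le) hr
    exact hno ⟨m, hm.trans hn, hm'⟩
  -- As long as no response has been sent, the operation stays pending, which blocks the next
  -- invocation of the same client.
  have key : ∀ n, π₁.idx + 1 ≤ n → n ≤ π₂.idx →
      (β.state n).pending π₁.client = some (π₁.opid, π₁.op) := by
    intro n hn
    induction n, hn using Nat.le_induction with
    | base => exact fun _ => (invoke_fresh π₁.idx_lt π₁.act_eq).2.2.2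
    | succ n _ ih =>
      intro hle
      have hn : (n : ℕ∞) < β.len := lt_of_succ_le_len (le_len_of_le hle π₂.idx_lt.le)
      rcases (β.stepEffect hn).pending_keep _ _ _ (ih (Nat.le_of_succ_le hle)) with h | ⟨r, hr, ha⟩
      · exact h
      · exact absurd ⟨r, hr, ha⟩ (hno' n (Nat.le_of_succ_le hle))
  have h := key π₂.idx hlt le_rfl
  rw [hc, (invoke_fresh π₂.idx_lt π₂.act_eq).1] at h
  simp at h

/-! ### The order on the operations -/

theorem Operation.not_isRead_of_isWrite {π : Operation β} {X Y : Fin K} {v : V}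
    (h : π.IsWrite X v) : ¬ π.IsRead Y := by
  cases π with
  | initial => exact id
  | invoked π =>
    intro h'
    simp only [Operation.IsWrite, Operation.IsRead] at h h'
    rw [h] at h'
    simp at h'

theorem Operation.isWrite_or_isRead (π : Operation β) :
    (∃ X v, π.IsWrite X v) ∨ ∃ X, π.IsRead X := by
  cases π with
  | initial X => exact Or.inl ⟨X, 0, rfl, rfl⟩
  | invoked π =>
    rcases h : π.op with ⟨X, v⟩ | ⟨X⟩
    exacts [Or.inl ⟨X, v, h⟩, Or.inr ⟨X, h⟩]

theorem ProgramOrder.trans {π₁ π₂ π₃ : Operation β} (h₁ : ProgramOrder π₁ π₂)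
    (h₂ : ProgramOrder π₂ π₃) : ProgramOrder π₁ π₃ := by
  cases π₁ <;> cases π₂ <;> cases π₃ <;> simp only [ProgramOrder] at h₁ h₂ ⊢
  exact ⟨h₁.1.trans h₂.1, h₁.2.trans h₂.2⟩

theorem ProgramOrder.irrefl (π : Operation β) : ¬ ProgramOrder π π := by
  cases π <;> simp [ProgramOrder]

/-- The first operation is answered before the second is invoked, and both are answered by the same
server, whose clock never decreases. If the timestamps are equal, the second operation cannot be a
write, as a write raises the clock strictly in the transition that answers it. -/
theorem timestampOrder_of_programOrder {π₁ π₂ : Operation β} (h : ProgramOrder π₁ π₂) :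
    TimestampOrder π₁ π₂ := by
  have hpo := h
  cases π₁ with
  | initial => exact absurd h id
  | invoked π₁ =>
  cases π₂ with
  | initial => exact absurd h id
  | invoked π₂ =>
  obtain ⟨hc, hlt⟩ := h
  obtain ⟨n₁, hle₁, h₁⟩ := exists_firstResponse_of_lt hc hlt
  have ht₁ := Invocation.hasTimestamp_iff.2 ⟨n₁, h₁, rfl⟩
  by_cases hT : ∃ T, (Operation.invoked π₂).HasTimestamp T
  swap
  · exact Or.inr (Or.inr (Or.inr ⟨⟨_, ht₁⟩, hT⟩))
  obtain ⟨T₂, hT₂⟩ := hT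
  obtain ⟨n₂, h₂, rfl⟩ := Invocation.hasTimestamp_iff.1 hT₂
  obtain ⟨r, hr, ha⟩ := h₂.2.1
  obtain ⟨k, rfl, hk, hrc⟩ := h₂.respCorrect hr ha
  rw [← hc] at hT₂ hrc
  have hle : ((β.state n₁).srv (P.home π₁.client)).vc ≤
      ((β.state k).srv (P.home π₁.client)).vc :=
    β.vc_mono (hle₁.trans hk) (le_len_of_le (Nat.le_succ k) h₂.1) _
  have hle' := β.vc_mono (Nat.le_succ k) h₂.1 (P.home π₁.client)
  rcases (hle.trans hle').lt_or_eq with hl | heq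
  · exact Or.inl ⟨_, _, ht₁, hT₂, hl⟩
  rcases hop : π₂.op with ⟨X, v⟩ | ⟨X⟩
  · rw [hop] at hrc
    exact absurd heq (ne_of_lt (lt_of_le_of_lt hle hrc))
  · rw [← Nat.succ_eq_add_one, ← heq] at hT₂
    rcases (Operation.invoked π₁).isWrite_or_isRead with hw | hrd
    · exact Or.inr (Or.inl ⟨_, ht₁, hT₂, hw, X, hop⟩)
    · exact Or.inr (Or.inr (Or.inl ⟨_, ht₁, hT₂, hrd, ⟨X, hop⟩, hpo⟩))

/-- Timestamps are unique, so the middle timestamps of a composition agree and a strict inequality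
absorbs equality. Among equal timestamps writes come before reads, and reads follow program order.
Operations without a timestamp have no successors. -/
theorem timestampOrder_isStrictOrder : IsStrictOrder (Operation β) TimestampOrder where
  irrefl π := by
    rintro (⟨T₁, T₂, h₁, h₂, hlt⟩ | ⟨T, -, -, ⟨X, v, hw⟩, Y, hr⟩ | ⟨T, -, -, -, -, h⟩ | ⟨h, h'⟩)
    · rw [h₁.unique h₂] at hlt; exact lt_irrefl _ hlt
    · exact Operation.not_isRead_of_isWrite hw hr
    · exact ProgramOrder.irrefl π h
    · exact h' h
  trans π₁ π₂ π₃ := by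
    rintro (⟨T₁, T₂, h₁, h₂, hlt⟩ | ⟨T, h₁, h₂, hw, X, hr⟩ | ⟨T, h₁, h₂, hr₁, ⟨X, hr⟩, hpo⟩ | ⟨h, h'⟩)
      (⟨T₁', T₂', h₁', h₂', hlt'⟩ | ⟨T', h₁', h₂', ⟨Y, v, hw'⟩, hr'⟩ |
        ⟨T', h₁', h₂', -, hr', hpo'⟩ | ⟨⟨T', h₁'⟩, hno⟩)
    · rw [← h₂.unique h₁'] at hlt'
      exact Or.inl ⟨_, _, h₁, h₂', hlt.trans hlt'⟩
    · rw [← h₂.unique h₁'] at h₂'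
      exact Or.inl ⟨_, _, h₁, h₂', hlt⟩
    · rw [← h₂.unique h₁'] at h₂'
      exact Or.inl ⟨_, _, h₁, h₂', hlt⟩
    · exact Or.inr (Or.inr (Or.inr ⟨⟨_, h₁⟩, hno⟩))
    · rw [← h₂.unique h₁'] at hlt'
      exact Or.inl ⟨_, _, h₁, h₂', hlt'⟩
    · exact absurd hr (Operation.not_isRead_of_isWrite hw')
    · rw [← h₂.unique h₁'] at h₂'
      exact Or.inr (Or.inl ⟨_, h₁, h₂', hw, hr'⟩)
    · exact Or.inr (Or.inr (Or.inr ⟨⟨_, h₁⟩, hno⟩))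
    · rw [← h₂.unique h₁'] at hlt'
      exact Or.inl ⟨_, _, h₁, h₂', hlt'⟩
    · exact absurd hr (Operation.not_isRead_of_isWrite hw')
    · rw [← h₂.unique h₁'] at h₂'
      exact Or.inr (Or.inr (Or.inl ⟨_, h₁, h₂', hr₁, hr', hpo.trans hpo'⟩))
    · exact Or.inr (Or.inr (Or.inr ⟨⟨_, h₁⟩, hno⟩))
    -- Here `π₂` has no timestamp, but every clause of the second relation requires one of its first
    -- argument.
    all_goals exact absurd ⟨_, h₁'⟩ ‹¬ ∃ T, π₂.HasTimestamp T›

/-! ### An extension of the timestamp order in which reads have unique sources. -/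

/-- The number of an operation among those with equal sums of the timestamp: writes come before
reads, reads are ordered by their invocations and writes in the opposite way. -/
def Operation.rank : Operation β → ℤ
  | .initial _ => 0
  | .invoked π => match π.op with
    | .write _ _ => -(π.idx + 1)
    | .read _ => π.idx + 1

/-- The sum of the timestamp of an operation (or of `0` if it has none). -/
noncomputable def Operation.weight (π : Operation β) : ℕ :=
  if h : ∃ T, π.HasTimestamp T then ∑ p, h.choose p else 0

/-- The key by which the operations with timestamps are ordered. -/
noncomputable def Operation.key (π : Operation β) : ℕ ×ₗ ℤ := toLex (π.weight, π.rank)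

/-- An extension of the timestamp order in which any two operations with timestamps that have
different keys are comparable. -/
def KeyOrder (π₁ π₂ : Operation β) : Prop :=
  (∃ T, π₁.HasTimestamp T) ∧ ((∃ T, π₂.HasTimestamp T) → π₁.key < π₂.key)

theorem Operation.HasTimestamp.weight_eq {π : Operation β} {T : Fin N → ℕ}
    (h : π.HasTimestamp T) : π.weight = ∑ p, T p := by
  have hex : ∃ T, π.HasTimestamp T := ⟨T, h⟩
  rw [Operation.weight, dif_pos hex, hex.choose_spec.unique h]

theorem Operation.IsWrite.rank_nonpos {π : Operation β} {X : Fin K} {v : V}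
    (h : π.IsWrite X v) : π.rank ≤ 0 := by
  cases π with
  | initial => exact le_rfl
  | invoked π =>
    have h' : π.op = .write X v := h
    simp only [Operation.rank, h']
    omega

theorem Operation.IsRead.rank_pos {π : Operation β} {X : Fin K} (h : π.IsRead X) :
    0 < π.rank := by
  cases π with
  | initial => exact absurd h id
  | invoked π =>
    have h' : π.op = .read X := h
    simp only [Operation.rank, h']
    omega

/-- The sum over components is strictly monotone for the componentwise order. For equal timestamps
the sign of the rank puts writes before reads, and the index orders the reads. -/
theorem keyOrder_of_timestampOrder {π₁ π₂ : Operation β} (h : TimestampOrder π₁ π₂) :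
    KeyOrder π₁ π₂ := by
  rcases h with ⟨T₁, T₂, h₁, h₂, hlt⟩ | ⟨T, h₁, h₂, ⟨X, v, hw⟩, Y, hr⟩ |
    ⟨T, h₁, h₂, ⟨X, hr₁⟩, ⟨Y, hr₂⟩, hpo⟩ | ⟨h, h'⟩
  · refine ⟨⟨_, h₁⟩, fun _ => Prod.Lex.toLex_lt_toLex.2 (Or.inl ?_)⟩
    rw [h₁.weight_eq, h₂.weight_eq]
    obtain ⟨hle, i, hi⟩ := Pi.lt_def.1 hlt
    exact Finset.sum_lt_sum (fun p _ => hle p) ⟨i, Finset.mem_univ i, hi⟩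
  · refine ⟨⟨_, h₁⟩, fun _ => Prod.Lex.toLex_lt_toLex.2 (Or.inr ⟨?_, ?_⟩)⟩
    · rw [h₁.weight_eq, h₂.weight_eq]
    · exact lt_of_le_of_lt hw.rank_nonpos hr.rank_pos
  · refine ⟨⟨_, h₁⟩, fun _ => Prod.Lex.toLex_lt_toLex.2 (Or.inr ⟨?_, ?_⟩)⟩
    · rw [h₁.weight_eq, h₂.weight_eq]
    · cases π₁ with
      | initial => exact absurd hr₁ id
      | invoked π₁ =>
      cases π₂ with
      | initial => exact absurd hr₂ id
      | invoked π₂ =>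
      have e₁ : π₁.op = .read X := hr₁
      have e₂ : π₂.op = .read Y := hr₂
      have := hpo.2
      simp only [Operation.rank, e₁, e₂]
      omega
  · exact ⟨h, fun h'' => absurd h'' h'⟩

theorem keyOrder_isStrictOrder : IsStrictOrder (Operation β) KeyOrder where
  irrefl _ h := lt_irrefl _ (h.2 h.1)
  trans _ _ _ h₁ h₂ := ⟨h₁.1, fun h => (h₁.2 h₂.1).trans (h₂.2 h)⟩

/-- A read with a timestamp that is preceded by some write of the value `v` reads from one. -/
theorem exists_readsFrom {r : Operation β → Operation β → Prop}
    (hr : ∀ π₁ π₂, r π₁ π₂ → KeyOrder π₁ π₂) {π : Operation β} (hπ : ∃ T, π.HasTimestamp T)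
    {X : Fin K} {v : V} {φ₀ : Operation β} (h₀ : r φ₀ π) (hw₀ : φ₀.IsWrite X v) :
    ∃ φ, ReadsFrom r π X v φ := by
  -- This measure decreases when a write moves up towards `π`. The truncated subtraction is exact
  -- because writes below `π` have at most its weight. Numbering writes against their invocation
  -- order makes `-rank` a natural number that falls as the key rises, so no finiteness of the set
  -- of writes is needed.
  let μ : Operation β → ℕ ×ₗ ℕ := fun φ => toLex (π.weight - φ.weight, (-φ.rank).toNat)
  obtain ⟨φ, ⟨hφ, hw⟩, hmin⟩ := (InvImage.wf μ wellFounded_lt).has_min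
    {φ | r φ π ∧ φ.IsWrite X v} ⟨φ₀, h₀, hw₀⟩
  refine ⟨φ, hφ, hw, fun ω h₁ h₂ hω => hmin ω ⟨h₂, hω⟩ ?_⟩
  have hωπ := (hr _ _ h₂).2 hπ
  have hφω := (hr _ _ h₁).2 (hr _ _ h₂).1
  have r₁ := hω.rank_nonpos
  have r₂ := hw.rank_nonpos
  refine Prod.Lex.toLex_lt_toLex.2 ?_
  dsimp only
  rcases Prod.Lex.toLex_lt_toLex.1 hωπ with a | ⟨a, -⟩ <;>
    rcases Prod.Lex.toLex_lt_toLex.1 hφω with b | ⟨b, b'⟩ <;> dsimp only at * <;> omega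

/-- The rank of a write is `0` exactly for initial writes and otherwise encodes the index of the
invocation, at which the execution performs just one action. The common object separates the initial
writes. -/
theorem Operation.IsWrite.eq_of_rank_eq {φ φ' : Operation β} {X : Fin K} {v : V}
    (h : φ.IsWrite X v) (h' : φ'.IsWrite X v) (he : φ.rank = φ'.rank) : φ = φ' := by
  rcases φ with Y | π <;> rcases φ' with Y' | π'
  · rw [h.1, h'.1]
  · have e : π'.op = .write X v := h'
    simp only [Operation.rank, e] at he
    omega
  · have e : π.op = .write X v := h
    simp only [Operation.rank, e] at he
    omega
  · have e : π.op = .write X v := h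
    have e' : π'.op = .write X v := h'
    simp only [Operation.rank, e, e'] at he
    have hidx : π.idx = π'.idx := by omega
    obtain ⟨i, c, o, op, hi, ha⟩ := π
    obtain ⟨i', c', o', op', hi', ha'⟩ := π'
    obtain rfl : i = i' := hidx
    have := ha.symm.trans ha'
    simp only [Action.invoke.injEq] at this
    obtain ⟨rfl, rfl, rfl⟩ := this
    rfl

theorem timestampOrder_of_le {φ π : Operation β} {T T' : Fin N → ℕ} {X Y : Fin K} {v : V}
    (hw : φ.IsWrite X v) (hr : π.IsRead Y) (hφ : φ.HasTimestamp T') (hπ : π.HasTimestamp T)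
    (hle : T' ≤ T) : TimestampOrder φ π := by
  rcases hle.lt_or_eq with hlt | rfl
  · exact Or.inl ⟨_, _, hφ, hπ, hlt⟩
  · exact Or.inr (Or.inl ⟨_, hφ, hπ, ⟨_, _, hw⟩, _, hr⟩)

theorem exists_readsFrom_timestampOrder {π : Operation β} {X : Fin K} {v : V} (hX : π.IsRead X)
    (hv : π.Returns v) : ∃ φ, ReadsFrom TimestampOrder π X v φ := by
  obtain ⟨T, hT, φ, T', hw, hφ, hle⟩ := exists_write_of_returns hX hv
  exact exists_readsFrom (fun _ _ => keyOrder_of_timestampOrder) ⟨T, hT⟩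
    (timestampOrder_of_le hw hX hφ hT hle) hw

theorem keyOrder_isCausalOrder : IsCausalOrder (KeyOrder (β := β)) where
  isStrictOrder := keyOrder_isStrictOrder
  programOrder _ _ h := keyOrder_of_timestampOrder (timestampOrder_of_programOrder h)
  reads π X v hX hv := by
    obtain ⟨T, hT, φ₀, T', hw₀, hφ₀, hle⟩ := exists_write_of_returns hX hv
    obtain ⟨φ, hφ⟩ := exists_readsFrom (fun _ _ => id) ⟨T, hT⟩
      (keyOrder_of_timestampOrder (timestampOrder_of_le hw₀ hX hφ₀ hT hle)) hw₀
    refine ⟨φ, hφ, fun φ' hφ' => ?_⟩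
    -- Of two candidate sources with different keys, the higher would be a write of `v` strictly
    -- between the lower one and the read.
    rcases lt_trichotomy φ.key φ'.key with hlt | heq | hlt
    · exact absurd hφ'.2.1 (hφ.2.2 φ' ⟨hφ.1.1, fun _ => hlt⟩ hφ'.1)
    · have : φ'.rank = φ.rank := (congrArg (fun x => (ofLex x).2) heq).symm
      exact hφ'.2.1.eq_of_rank_eq hφ.2.1 this
    · exact absurd hφ.2.1 (hφ'.2.2 φ ⟨hφ'.1.1, fun _ => hlt⟩ hφ.1)

end Executions

end CausalEC

end

theorem mainTheorem1 {N K : ℕ} {F V C I : Type*} {W : Fin N → Type*}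
    [Field F] [AddCommGroup V] [Module F V] [∀ i, AddCommGroup (W i)] [∀ i, Module F (W i)]
    (P : CausalEC.Params N K F V W C) (β : CausalEC.Execution P I) :
    CausalEC.CausallyConsistent β ∧
    IsStrictOrder (CausalEC.Operation β) CausalEC.TimestampOrder ∧
    (∀ π₁ π₂ : CausalEC.Operation β,
      CausalEC.ProgramOrder π₁ π₂ → CausalEC.TimestampOrder π₁ π₂) ∧
    (∀ (π : CausalEC.Operation β) (X : Fin K) (v : V), π.IsRead X → π.Returns v →
      ∃ φ, CausalEC.ReadsFrom CausalEC.TimestampOrder π X v φ) ∧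
    ∃ r : CausalEC.Operation β → CausalEC.Operation β → Prop,
      (∀ π₁ π₂, CausalEC.TimestampOrder π₁ π₂ → r π₁ π₂) ∧ CausalEC.IsCausalOrder r :=
  ⟨⟨_, CausalEC.keyOrder_isCausalOrder⟩, CausalEC.timestampOrder_isStrictOrder,
    fun _ _ => CausalEC.timestampOrder_of_programOrder,
    fun _ _ _ => CausalEC.exists_readsFrom_timestampOrder,
    CausalEC.KeyOrder, fun _ _ => CausalEC.keyOrder_of_timestampOrder,
    CausalEC.keyOrder_isCausalOrder⟩
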